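/- Let $(\mathcal A,\tau)$ be a tracial von Neumann algebra, i.e. a von Neumann algebra $\mathcal A$ with a faithful, normal, tracial state $\tau$, and let $a\in\mathcal A$. Let $L^2(\mathcal A,\tau)$ be the completion of $\mathcal A$ in the norm $\|x\|_2=\tau(x^*x)^{1/2}$; left and right multiplication by elements of $\mathcal A$ extend continuously to $L^2(\mathcal A,\tau)$. An element $x\in\mathcal A$ has an inverse in $L^2$ if there is $b\in L^2(\mathcal A,\tau)$ with $xb=bx=1$. Let $\mathrm{spec}^2_2(a)$ be the complement of the set of all $\lambda_0\in\mathbb C$ such that $(a-\lambda)^2$ has an inverse $(a-\lambda)^{-2}$ in $L^2$ for all $\lambda$ in a neighborhood of $\lambda_0$, with $\|(a-\lambda)^{-2}\|_2$ bounded near $\lambda_0$. For $x\in\mathcal A$ let $$\log\Delta(x)=\lim_{\varepsilon\to0^+}\tfrac12\,\tau\big[\log(x^*x+\varepsilon)\big]\in[-\infty,\infty).$$ The function $\lambda\mapsto\log\Delta(a-\lambda)$ is almost everywhere finite and locally integrable on $\mathbb C$, and there is a unique locally finite Borel measure $\mu_a$ on $\mathbb C$, the Brown measure of $a$, with $$\int_{\mathbb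 C}\varphi\,d\mu_a=\frac1{2\pi}\int_{\mathbb C}\log\Delta(a-\lambda)\,\nabla^2\varphi(\lambda)\,d^2\lambda\qquad\text{for all }\varphi\in C_c^\infty(\mathbb C),$$ where $\nabla^2$ is the Laplacian and $d^2\lambda$ is Lebesgue measure on the plane. Moreover $$\operatorname{supp}\mu_a\subseteq\mathrm{spec}^2_2(a)\subseteq\mathrm{spec}(a),$$ where $\mathrm{spec}(a)$ is the spectrum of $a$ in $\mathcal A$. That is, if $(a-\lambda)^2$ has an inverse in $L^2$ for all $\lambda$ near $\lambda_0$, with locally bounded $L^2$-norm, then $\lambda_0\notin\operatorname{supp}\mu_a$. -/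

import Mathlib

open scoped ComplexOrder ContDiff Topology
open Filter MeasureTheory UniformSpace

universe u

/-- Normality of a linear functional on a von Neumann algebra: continuity with respect to the
weak-⋆ topology of `A`, i.e. the topology transported from the weak dual of a Banach space `X`
whose dual is isometrically isomorphic to `A`. (By Sakai's theorem the predual, hence this
topology, is unique.) As in Mathlib's `WStarAlgebra`, the identification is conjugate-linear, which
makes no difference: replace `X` by its complex conjugate. -/
def IsNormalFunctional {A : Type u} [CStarAlgebra A] (φ : A →ₗ[ℂ] ℂ) : Prop :=
  ∃ (X : Type u) (_ : NormedAddCommGroup X) (_ : NormedSpace ℂ X) (_ : CompleteSpace X)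
    (e : StrongDual ℂ X ≃ₗᵢ⋆[ℂ] A),
    Continuous fun f : WeakDual ℂ X => φ (e (WeakDual.toStrongDual f))

/-- A faithful, normal, tracial state on a von Neumann algebra `A`. A von Neumann algebra which has
one is automatically finite, so `A` together with such a state is a tracial von Neumann
algebra. -/
structure FaithfulNormalTrace (A : Type u) [CStarAlgebra A] [PartialOrder A] [StarOrderedRing A]
    [WStarAlgebra A] where
  /-- the underlying positive linear functional -/
  toPos : A →ₚ[ℂ] ℂ
  map_one : toPos 1 = 1
  faithful : ∀ x : A, toPos (star x * x) = 0 → x = 0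
  normal : IsNormalFunctional (toPos : A →ₗ[ℂ] ℂ)
  trace : ∀ x y : A, toPos (x * y) = toPos (y * x)

namespace FaithfulNormalTrace

variable {A : Type u} [CStarAlgebra A] [PartialOrder A] [StarOrderedRing A] [WStarAlgebra A]
  (τ : FaithfulNormalTrace A)

/-- The noncommutative `L²` space: the completion of `A` for the norm
`‖x‖₂ = τ(x⋆ x) ^ (1/2)`. -/
abbrev L2 : Type u := τ.toPos.GNS

/-- The canonical map of `A` into `L²`. -/
noncomputable def toL2 (x : A) : τ.L2 := ((τ.toPos.toPreGNS x : τ.toPos.PreGNS) : τ.L2)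

/-- Left multiplication by `x ∈ A` on `L²`, the continuous extension of `y ↦ x * y`. -/
noncomputable def leftMul (x : A) : τ.L2 →L[ℂ] τ.L2 := (τ.toPos.leftMulMapPreGNS x).completion

/-- Right multiplication `y ↦ y * x` on `A` with the norm of `L²`; it is bounded by `‖x‖` because
`τ` is a trace. -/
noncomputable def rightMulPre (x : A) : τ.toPos.PreGNS →L[ℂ] τ.toPos.PreGNS :=
  τ.toPos.toPreGNS.toLinearMap ∘ₗ LinearMap.mulRight ℂ x ∘ₗ τ.toPos.ofPreGNS.toLinearMap
    |>.mkContinuous ‖x‖ fun y ↦ by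
    rw [← sq_le_sq₀ (by positivity) (by positivity), mul_pow, ← RCLike.ofReal_le_ofReal (K := ℂ),
      RCLike.ofReal_pow, RCLike.ofReal_eq_complex_ofReal, PositiveLinearMap.preGNS_norm_sq]
    set z := τ.toPos.ofPreGNS y with hz
    have key : z * (x * star x) * star z ≤ ‖x‖ ^ 2 • (z * star z) := by
      have h := CStarAlgebra.star_right_conjugate_le_norm_smul (a := z) (b := x * star x)
        (hb := IsSelfAdjoint.mul_star_self x)
      rwa [CStarRing.norm_self_mul_star, ← sq] at h
    have hτ : τ.toPos (star (z * x) * (z * x)) = τ.toPos (z * (x * star x) * star z) := by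
      rw [τ.trace]
      simp [mul_assoc]
    calc
      _ = τ.toPos (z * (x * star x) * star z) := by
        rw [← hτ]; simp [hz]
      _ ≤ τ.toPos (‖x‖ ^ 2 • (z * star z)) := OrderHomClass.mono τ.toPos key
      _ = _ := by
        rw [← Complex.coe_smul, map_smul, τ.trace z, smul_eq_mul, Complex.ofReal_mul,
          Complex.ofReal_pow ‖y‖, PositiveLinearMap.preGNS_norm_sq]

/-- Right multiplication by `x ∈ A` on `L²`, the continuous extension of `y ↦ y * x`. -/
noncomputable def rightMul (x : A) : τ.L2 →L[ℂ] τ.L2 := (τ.rightMulPre x).completion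

theorem leftMul_toL2 (x y : A) : τ.leftMul x (τ.toL2 y) = τ.toL2 (x * y) := by
  simp [leftMul, toL2]

theorem rightMul_toL2 (x y : A) : τ.rightMul x (τ.toL2 y) = τ.toL2 (y * x) := by
  simp [rightMul, toL2, rightMulPre]

/-- `b ∈ L²` is an inverse in `L²` of `x ∈ A`: `x b = b x = 1`. -/
def IsL2Inverse (x : A) (b : τ.L2) : Prop :=
  τ.leftMul x b = τ.toL2 1 ∧ τ.rightMul x b = τ.toL2 1

/-- The `L²ₙ`-resolvent set of `a`: the points `l₀` such that, for all `l` in a neighbourhood of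
`l₀`, the element `(a - l) ^ n` has an inverse in `L²`, with locally bounded `L²`-norm. -/
def l2ResolventSet (n : ℕ) (a : A) : Set ℂ :=
  {l₀ | ∃ C : ℝ, ∀ᶠ l in 𝓝 l₀, ∃ b : τ.L2,
    τ.IsL2Inverse ((a - algebraMap ℂ A l) ^ n) b ∧ ‖b‖ ≤ C}

/-- The `L²ₙ`-spectrum of `a`. -/
def l2Spectrum (n : ℕ) (a : A) : Set ℂ := (τ.l2ResolventSet n a)ᶜ

/-- The logarithm of the Fuglede–Kadison determinant,
`log Δ(x) = lim_{ε → 0⁺} ½ τ(log (x⋆ x + ε))`, with values in `[-∞, ∞)`. The expression is monotone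
in `ε`, so that the limit exists. -/
noncomputable def logDet (x : A) : EReal :=
  limUnder (𝓝[>] (0 : ℝ)) fun ε : ℝ =>
    (((1 / 2) * (τ.toPos (CFC.log (star x * x + algebraMap ℝ A ε))).re : ℝ) : EReal)

/-- `μ` is the Brown measure of `a`: a locally finite Borel measure on the plane which represents
the distributional Laplacian of `l ↦ (2π)⁻¹ log Δ(a - l)`. The first two conditions on `log Δ` do
not involve `μ`; they say that `log Δ(a - l)` is a locally integrable function, and hence a
distribution. -/
structure IsBrownMeasure (a : A) (μ : Measure ℂ) : Prop where
  locallyFinite : IsLocallyFiniteMeasure μ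
  ae_ne_bot : ∀ᵐ l : ℂ, τ.logDet (a - algebraMap ℂ A l) ≠ ⊥
  locallyIntegrable :
    LocallyIntegrable fun l : ℂ => (τ.logDet (a - algebraMap ℂ A l)).toReal
  integral_eq : ∀ φ : ℂ → ℝ, ContDiff ℝ ∞ φ → HasCompactSupport φ →
    ∫ l, φ l ∂μ = (2 * Real.pi)⁻¹ *
      ∫ l : ℂ, (τ.logDet (a - algebraMap ℂ A l)).toReal * Laplacian.laplacian φ l

end FaithfulNormalTrace

/-!
# The Brown measure is supported in the `L²₂`-spectrum

For `x = a - l` and `ε > 0` put `L ε l = ½ τ(log (x⋆ x + ε))`, which decreases to `log Δ(a - l)` as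
`ε → 0⁺`. Because `τ` is a trace, `log` differentiates under `τ` as if everything commuted
(`abs_trace_log_sub_le`), so that `L ε` is smooth and a second differentiation gives the closed form
`∇² L ε = 2 ε τ((x⋆ x + ε)⁻¹ (x x⋆ + ε)⁻¹)` (`FaithfulNormalTrace.laplacian_regLogDet`). This is
nonnegative, being the trace of a product of two positive elements: `L ε` is subharmonic.

*Existence.* For `|l|` large, `L ε l ≥ 0`. A sub-mean value inequality, obtained by integrating
`∇² L ε ≥ 0` against one radial test function (`exists_setIntegral_sub_le`), carries this lower bound
to the integrals of `L ε` over arbitrary discs, uniformly in `ε`. By monotone convergence the limit is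
finite almost everywhere and locally integrable, and `∫ ∇² (L ε) φ = ∫ L ε ∇² φ` converges for each
test function `φ`. The positive functionals `f ↦ ∫ ∇² (L ε) f` on `C_c(ℂ)` are bounded at each `f`,
so they have a limit along an ultrafilter, which is a measure by the Riesz-Markov-Kakutani theorem
(`IsSubharmonicRegularization.exists_measure`).

*Uniqueness.* Smooth functions with compact support approximate indicator functions of bounded open
sets (`measure_ext_of_integral_contDiff`).

*Support.* If `b ∈ L²` is an inverse of `x ^ 2`, then also `x b x = 1`, because multiplication by
`x ^ 2` is injective on `L²` (`FaithfulNormalTrace.leftMul_injective_of_rightMul_eq`). With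
`P = (x⋆ x + ε)⁻¹` and `Q = (x x⋆ + ε)⁻¹` this gives `τ(Q P) = ⟨b, (x⋆ Q x) b (x P x⋆)⟩ ≤ ‖b‖ ^ 2`,
since `x⋆ Q x = P x⋆ x` and `x P x⋆ = Q x x⋆` are contractions
(`FaithfulNormalTrace.reTrace_shiftInv_mul_shiftInv_le`). Where `‖b‖` is locally bounded,
`∇² L ε = O(ε)` tends to `0` uniformly, and the Brown measure vanishes.
-/

/-! ### Shifted inverses and logarithms of positive elements -/

section ShiftedInverse

variable {A : Type u} [CStarAlgebra A]

/-- The inverse `(h + s)⁻¹` of a shift of `h` by a real scalar `s`. It is only used for `0 ≤ h` and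
`0 < s`, where the inverse exists. -/
noncomputable def shiftInv (h : A) (s : ℝ) : A := Ring.inverse (h + algebraMap ℝ A s)

variable [PartialOrder A] [StarOrderedRing A] {h : A} {s : ℝ}

theorem isStrictlyPositive_shift (hh : 0 ≤ h) (hs : 0 < s) :
    IsStrictlyPositive (h + algebraMap ℝ A s) := by
  grind

theorem isUnit_shift (hh : 0 ≤ h) (hs : 0 < s) : IsUnit (h + algebraMap ℝ A s) :=
  (isStrictlyPositive_shift hh hs).isUnit

theorem cfc_shift (hh : 0 ≤ h) (s : ℝ) :
    cfc (fun t : ℝ => t + s) h = h + algebraMap ℝ A s := by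
  rw [cfc_add_const s (fun t : ℝ => t) h, cfc_id' ℝ h]

theorem shiftInv_eq_cfc (hh : 0 ≤ h) (hs : 0 < s) :
    shiftInv h s = cfc (fun t : ℝ => (t + s)⁻¹) h := by
  rw [shiftInv, ← cfc_shift hh, cfc_inv (fun t : ℝ => t + s) h]
  intro t ht
  have := spectrum_nonneg_of_nonneg hh ht
  positivity

theorem log_shift_eq_cfc (hh : 0 ≤ h) (hs : 0 < s) :
    CFC.log (h + algebraMap ℝ A s) = cfc (fun t : ℝ => Real.log (t + s)) h := by
  have hc : ContinuousOn Real.log ((fun t : ℝ => t + s) '' spectrum ℝ h) := by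
    refine Real.continuousOn_log.mono ?_
    rintro _ ⟨t, ht, rfl⟩
    have := spectrum_nonneg_of_nonneg hh ht
    simp only [Set.mem_compl_iff, Set.mem_singleton_iff]
    positivity
  rw [CFC.log, ← cfc_shift hh, cfc_comp' Real.log (fun t : ℝ => t + s) h hc]

theorem continuousOn_shift_inv (hh : 0 ≤ h) (hs : 0 < s) :
    ContinuousOn (fun t : ℝ => (t + s)⁻¹) (spectrum ℝ h) := by
  refine ContinuousOn.inv₀ (by fun_prop) fun t ht => ?_
  have := spectrum_nonneg_of_nonneg hh ht
  positivity

theorem continuousOn_shift_log (hh : 0 ≤ h) (hs : 0 < s) :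
    ContinuousOn (fun t : ℝ => Real.log (t + s)) (spectrum ℝ h) := by
  refine ContinuousOn.log (by fun_prop) fun t ht => ?_
  have := spectrum_nonneg_of_nonneg hh ht
  positivity

theorem shiftInv_nonneg (hh : 0 ≤ h) (hs : 0 < s) : 0 ≤ shiftInv h s := by
  rw [shiftInv_eq_cfc hh hs]
  refine cfc_nonneg fun t ht => ?_
  have := spectrum_nonneg_of_nonneg hh ht
  positivity

theorem norm_shiftInv_le (hh : 0 ≤ h) (hs : 0 < s) : ‖shiftInv h s‖ ≤ s⁻¹ := by
  rw [shiftInv_eq_cfc hh hs]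
  refine norm_cfc_le (by positivity) fun t ht => ?_
  have := spectrum_nonneg_of_nonneg hh ht
  rw [Real.norm_of_nonneg (by positivity)]
  gcongr
  linarith

theorem shiftInv_mul_shift (hh : 0 ≤ h) (hs : 0 < s) :
    shiftInv h s * (h + algebraMap ℝ A s) = 1 :=
  Ring.inverse_mul_cancel _ (isUnit_shift hh hs)

theorem shift_mul_shiftInv (hh : 0 ≤ h) (hs : 0 < s) :
    (h + algebraMap ℝ A s) * shiftInv h s = 1 :=
  Ring.mul_inverse_cancel _ (isUnit_shift hh hs)

theorem norm_shiftInv_mul_self_le (hh : 0 ≤ h) (hs : 0 < s) : ‖shiftInv h s * h‖ ≤ 1 := by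
  have hc := continuousOn_shift_inv hh hs
  rw [shiftInv_eq_cfc hh hs]
  conv_lhs => rw [← cfc_id' ℝ h, cfc_id' ℝ h]
  rw [show cfc (fun t : ℝ => (t + s)⁻¹) h * h = cfc (fun t : ℝ => (t + s)⁻¹ * t) h by
    rw [cfc_mul _ _ h hc, cfc_id' ℝ h]]
  refine norm_cfc_le zero_le_one fun t ht => ?_
  have := spectrum_nonneg_of_nonneg hh ht
  rw [Real.norm_of_nonneg (by positivity), inv_mul_le_iff₀ (by positivity)]
  linarith

theorem shiftInv_sub_shiftInv {h' : A} (hh : 0 ≤ h) (hh' : 0 ≤ h') (hs : 0 < s) :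
    shiftInv h s - shiftInv h' s = shiftInv h s * (h' - h) * shiftInv h' s := by
  rw [shiftInv, shiftInv, Ring.inverse_sub_inverse
    (iff_of_true (isUnit_shift hh hs) (isUnit_shift hh' hs))]
  simp

theorem hasFDerivAt_ringInverse_shift (hh : 0 ≤ h) (hs : 0 < s) :
    HasFDerivAt (fun y : A => shiftInv y s)
      (-(ContinuousLinearMap.mulLeftRight ℝ A (shiftInv h s) (shiftInv h s))) h := by
  obtain ⟨w, hw⟩ := isUnit_shift hh hs
  have h1 := hasFDerivAt_ringInverse (𝕜 := ℝ) w
  have h2 : HasFDerivAt (fun y : A => y + algebraMap ℝ A s) (ContinuousLinearMap.id ℝ A) h :=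
    (hasFDerivAt_id h).add_const _
  rw [hw] at h1
  have h3 := h1.comp h h2
  have hi : shiftInv h s = ↑w⁻¹ := by rw [shiftInv, ← hw, Ring.inverse_unit]
  rw [hi]
  exact h3

theorem hasDerivAt_shiftInv (hh : 0 ≤ h) (hs : 0 < s) :
    HasDerivAt (shiftInv h) (-(shiftInv h s * shiftInv h s)) s := by
  obtain ⟨w, hw⟩ := isUnit_shift hh hs
  have h1 := hasFDerivAt_ringInverse (𝕜 := ℝ) w
  have h2 : HasDerivAt (fun r : ℝ => h + algebraMap ℝ A r) 1 s := by
    have := ((Algebra.linearMap ℝ A).toContinuousLinearMap.hasDerivAt (x := s)).const_add h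
    simpa using this
  rw [hw] at h1
  have h3 := h1.comp_hasDerivAt s h2
  have hi : shiftInv h s = ↑w⁻¹ := by rw [shiftInv, ← hw, Ring.inverse_unit]
  rw [hi]
  simpa using! h3

/-- The elementary two-sided bound `1 - 1/y ≤ log y ≤ y - 1`, for `y = b / a`. -/
theorem abs_log_sub_log_sub_le {a b : ℝ} (ha : 0 < a) (hb : 0 < b) :
    |Real.log b - Real.log a - (b - a) * a⁻¹| ≤ (b - a) ^ 2 / (a * b) := by
  have hy : 0 < b / a := by positivity
  have h1 := Real.log_le_sub_one_of_pos hy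
  have h2 := Real.one_sub_inv_le_log_of_pos hy
  rw [Real.log_div hb.ne' ha.ne'] at h1 h2
  have e1 : (b - a) * a⁻¹ = b / a - 1 := by field_simp
  have e2 : (b - a) ^ 2 / (a * b) = b / a - 1 - (1 - (b / a)⁻¹)   := by field_simp
  rw [e1, e2, abs_le]
  constructor <;> linarith [inv_nonneg.2 hy.le]

theorem hasDerivAt_log_shift (hh : 0 ≤ h) (hs : 0 < s) :
    HasDerivAt (fun r : ℝ => CFC.log (h + algebraMap ℝ A r)) (shiftInv h s) s := by
  rw [hasDerivAt_iff_isLittleO]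
  have key : (fun r : ℝ => CFC.log (h + algebraMap ℝ A r) - CFC.log (h + algebraMap ℝ A s) -
      (r - s) • shiftInv h s) =O[𝓝 s] fun r => (r - s) ^ 2 := by
    refine Asymptotics.IsBigO.of_bound (2 / s ^ 2) ?_
    filter_upwards [eventually_gt_nhds (show s / 2 < s by linarith)] with r hr
    have hr0 : 0 < r := by linarith
    have hc1 := continuousOn_shift_log hh hr0
    have hc2 := continuousOn_shift_log hh hs
    have hc3 := continuousOn_shift_inv hh hs
    rw [log_shift_eq_cfc hh hr0, log_shift_eq_cfc hh hs, shiftInv_eq_cfc hh hs,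
      ← cfc_sub _ _ h hc1 hc2, ← cfc_smul _ _ h hc3, ← cfc_sub _ _ h (by exact hc1.sub hc2)
      (by exact hc3.const_smul (r - s))]
    refine norm_cfc_le (by positivity) fun t ht => ?_
    have ht0 := spectrum_nonneg_of_nonneg hh ht
    have := abs_log_sub_log_sub_le (a := t + s) (b := t + r) (by positivity) (by positivity)
    rw [add_sub_add_left_eq_sub] at this
    refine this.trans ?_
    rw [Real.norm_of_nonneg (sq_nonneg _), div_mul_eq_mul_div, div_le_div_iff₀ (by positivity)
      (by positivity)]
    have h3 : s ^ 2 ≤ 2 * ((t + s) * (t + r)) := by nlinarith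
    nlinarith [sq_nonneg (r - s)]
  refine key.trans_isLittleO ?_
  simpa using Asymptotics.isLittleO_pow_sub_sub s (m := 2) (by norm_num)

theorem norm_log_shift_sub_le (hh : 0 ≤ h) (hs : 0 < s) :
    ‖CFC.log (h + algebraMap ℝ A s) - algebraMap ℝ A (Real.log s)‖ ≤ ‖h‖ / s := by
  nontriviality A
  have hc := continuousOn_shift_log hh hs
  rw [log_shift_eq_cfc hh hs, ← cfc_const (Real.log s) h, ← cfc_sub _ _ h hc]
  refine norm_cfc_le (by positivity) fun t ht => ?_
  have ht0 := spectrum_nonneg_of_nonneg hh ht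
  have ht1 : t ≤ ‖h‖ := (le_abs_self t).trans (spectrum.norm_le_norm_of_mem ht)
  have h1 : Real.log s ≤ Real.log (t + s) := Real.log_le_log hs (by linarith)
  have h2 := Real.log_le_sub_one_of_pos (show 0 < (t + s) / s by positivity)
  rw [Real.log_div (by positivity) hs.ne'] at h2
  rw [Real.norm_of_nonneg (by linarith)]
  calc _ ≤ (t + s) / s - 1 := h2
    _ = t / s := by field_simp; ring
    _ ≤ _ := by gcongr

/-- A bounded functional which is a trace differentiates `log (h + s)` as if everything commuted:
the first order Taylor expansion has a remainder which is quadratic in `h' - h`. The remainder at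
`s` tends to `0` as `s → ∞`, and its derivative in `s` is `O(‖h' - h‖ ^ 2 / s ^ 3)`. -/
theorem abs_trace_log_sub_le (T : A →L[ℝ] ℝ) (hT : ∀ x y, T (x * y) = T (y * x)) {h' : A}
    (hh : 0 ≤ h) (hh' : 0 ≤ h') (hs : 0 < s) :
    |T (CFC.log (h' + algebraMap ℝ A s)) - T (CFC.log (h + algebraMap ℝ A s)) -
      T (shiftInv h s * (h' - h))| ≤ ‖T‖ * ‖h' - h‖ ^ 2 / (2 * s ^ 2) := by
  set d := h' - h with hd
  set K := ‖T‖ * ‖d‖ ^ 2 with hK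
  set F : ℝ → ℝ := fun r => T (CFC.log (h' + algebraMap ℝ A r)) -
    T (CFC.log (h + algebraMap ℝ A r)) - T (shiftInv h r * d) with hF
  have hder : ∀ r : ℝ, 0 < r → HasDerivAt F (T (shiftInv h' r) - T (shiftInv h r) -
      T (-(shiftInv h r * shiftInv h r) * d)) r := fun r hr =>
    ((T.hasFDerivAt.comp_hasDerivAt r (hasDerivAt_log_shift hh' hr)).sub
      (T.hasFDerivAt.comp_hasDerivAt r (hasDerivAt_log_shift hh hr))).sub
      (T.hasFDerivAt.comp_hasDerivAt r ((hasDerivAt_shiftInv hh hr).mul_const d))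
  have hbound : ∀ r : ℝ, 0 < r → |T (shiftInv h' r) - T (shiftInv h r) -
      T (-(shiftInv h r * shiftInv h r) * d)| ≤ K / r ^ 3 := by
    intro r hr
    have e1 : T (shiftInv h' r) - T (shiftInv h r) = -T (shiftInv h' r * shiftInv h r * d) := by
      rw [← map_sub, ← neg_sub, map_neg, shiftInv_sub_shiftInv hh hh' hr, hT, mul_assoc]
    have e3 : T (shiftInv h' r) - T (shiftInv h r) - T (-(shiftInv h r * shiftInv h r) * d) =
        T (shiftInv h r * d * shiftInv h' r * shiftInv h r * d) := by
      rw [e1, ← shiftInv_sub_shiftInv hh hh' hr, ← map_neg, ← map_sub]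
      congr 1
      noncomm_ring
    rw [e3]
    have n1 := norm_shiftInv_le hh hr
    have n2 := norm_shiftInv_le hh' hr
    calc |T (shiftInv h r * d * shiftInv h' r * shiftInv h r * d)|
        ≤ ‖T‖ * ‖shiftInv h r * d * shiftInv h' r * shiftInv h r * d‖ := T.le_opNorm _
      _ ≤ ‖T‖ * (r⁻¹ * ‖d‖ * r⁻¹ * r⁻¹ * ‖d‖) := by
        gcongr
        refine (norm_mul_le _ _).trans ?_
        gcongr
        refine (norm_mul_le _ _).trans ?_
        gcongr
        refine (norm_mul_le _ _).trans ?_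
        gcongr
        refine (norm_mul_le _ _).trans ?_
        gcongr
      _ = K / r ^ 3 := by rw [hK]; field_simp
  have hlim : Tendsto F atTop (𝓝 0) := by
    have hb : ∀ r : ℝ, 0 < r → ‖F r‖ ≤ ‖T‖ * (‖h'‖ + ‖h‖ + ‖d‖) * r⁻¹ := by
      intro r hr
      have e : F r = T ((CFC.log (h' + algebraMap ℝ A r) - algebraMap ℝ A (Real.log r)) -
          (CFC.log (h + algebraMap ℝ A r) - algebraMap ℝ A (Real.log r)) - shiftInv h r * d) := by
        simp only [hF, map_sub]
        ring
      rw [e]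
      refine (T.le_opNorm _).trans ?_
      rw [mul_assoc]
      gcongr
      calc _ ≤ ‖h'‖ / r + ‖h‖ / r + r⁻¹ * ‖d‖ := by
            refine (norm_sub_le _ _).trans ?_
            gcongr
            · refine (norm_sub_le _ _).trans ?_
              gcongr
              · exact norm_log_shift_sub_le hh' hr
              · exact norm_log_shift_sub_le hh hr
            · refine (norm_mul_le _ _).trans ?_
              gcongr
              exact norm_shiftInv_le hh hr
        _ = _ := by field_simp
    refine squeeze_zero_norm' ?_ (a := fun r => ‖T‖ * (‖h'‖ + ‖h‖ + ‖d‖) * r⁻¹) ?_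
    · filter_upwards [eventually_gt_atTop 0] with r hr using hb r hr
    · simpa using tendsto_inv_atTop_zero.const_mul (‖T‖ * (‖h'‖ + ‖h‖ + ‖d‖))
  -- `K / (2 r ^ 2)` has derivative `-K / r ^ 3`, so adding it to `± F` gives antitone functions.
  have hpos : ∀ (σ : ℝ) (G G' : ℝ → ℝ), |σ| = 1 → (∀ r, 0 < r → HasDerivAt G (G' r) r) →
      (∀ r, 0 < r → |G' r| ≤ K / r ^ 3) → Tendsto G atTop (𝓝 0) →
      0 ≤ σ * G s + K / (2 * s ^ 2) := by
    intro σ G G' hσ hG hG' hGl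
    set E : ℝ → ℝ := fun r => σ * G r + K / 2 * (r ^ 2)⁻¹ with hE
    have hEd : ∀ r, 0 < r → HasDerivAt E (σ * G' r - K / r ^ 3) r := by
      intro r hr
      have h1 := ((hG r hr).const_mul σ).add
        (((hasDerivAt_pow 2 r).fun_inv (by positivity)).const_mul (K / 2))
      refine HasDerivAt.congr_deriv (f := E) h1 ?_
      push_cast
      field_simp
      ring
    have hanti : AntitoneOn E (Set.Ioi 0) := by
      refine antitoneOn_of_deriv_nonpos (convex_Ioi 0)
        (fun r hr => (hEd r hr).continuousAt.continuousWithinAt)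
        (fun r hr => (hEd r (interior_subset hr)).differentiableAt.differentiableWithinAt)
        fun r hr => ?_
      have hr := interior_subset hr
      rw [(hEd r hr).deriv]
      have := hG' r hr
      have h2 : σ * G' r ≤ |G' r| := by
        refine (le_abs_self _).trans ?_
        rw [abs_mul, hσ, one_mul]
      linarith
    have hEl : Tendsto E atTop (𝓝 0) := by
      have h1 : Tendsto (fun r : ℝ => (r ^ 2)⁻¹) atTop (𝓝 0) :=
        tendsto_inv_atTop_zero.comp (tendsto_pow_atTop (by norm_num))
      simpa using (hGl.const_mul σ).add (h1.const_mul (K / 2))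
    have : 0 ≤ E s := by
      refine le_of_tendsto hEl ?_
      filter_upwards [eventually_ge_atTop s] with r hr
      exact hanti (Set.mem_Ioi.2 hs) (Set.mem_Ioi.2 (hs.trans_le hr)) hr
    rw [hE] at this
    convert this using 2
    field_simp
  have p1 := hpos 1 F _ (by simp) hder hbound hlim
  have p2 := hpos (-1) F _ (by simp) hder hbound hlim
  rw [abs_le]
  simp only [hF] at p1 p2
  constructor <;> linarith

end ShiftedInverse

/-! ### Second derivatives in the plane -/

theorem laplacian_eq_fderiv_fderiv {f : ℂ → ℝ} (hf : ContDiff ℝ 2 f) (l : ℂ) :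
    Laplacian.laplacian f l = fderiv ℝ (fun y => fderiv ℝ f y 1) l 1 +
      fderiv ℝ (fun y => fderiv ℝ f y Complex.I) l Complex.I := by
  have hd : DifferentiableAt ℝ (fderiv ℝ f) l :=
    (hf.fderiv_right (m := 1) (by norm_num)).differentiable (by norm_num) l
  rw [InnerProductSpace.laplacian_eq_iteratedFDeriv_complexPlane]
  simp only [iteratedFDeriv_two_apply, Matrix.cons_val_zero, Matrix.cons_val_one]
  rw [fderiv_clm_apply hd (by fun_prop), fderiv_clm_apply hd (by fun_prop)]
  simp

/-! ### The function `(a - l)⋆ (a - l)` -/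

section CStarAlgebra

variable {A : Type u} [CStarAlgebra A]

theorem contDiff_absSq (a : A) : ContDiff ℝ ω
    (fun l : ℂ => star (a - algebraMap ℂ A l) * (a - algebraMap ℂ A l)) := by
  have h1 : ContDiff ℝ ω (fun l : ℂ => a - algebraMap ℂ A l) :=
    contDiff_const.sub
      ((Algebra.linearMap ℂ A).toContinuousLinearMap.restrictScalars ℝ).contDiff
  have h2 : ContDiff ℝ ω (fun l : ℂ => star (a - algebraMap ℂ A l)) :=
    (starL' ℝ : A ≃L[ℝ] A).contDiff.comp h1
  exact h2.mul h1

theorem fderiv_absSq (a : A) (l v : ℂ) :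
    fderiv ℝ (fun l : ℂ => star (a - algebraMap ℂ A l) * (a - algebraMap ℂ A l)) l v =
      -(v • star (a - algebraMap ℂ A l) + star v • (a - algebraMap ℂ A l)) := by
  set ι : ℂ →L[ℝ] A := (Algebra.linearMap ℂ A).toContinuousLinearMap.restrictScalars ℝ with hι
  have h1 : HasFDerivAt (fun l : ℂ => a - algebraMap ℂ A l) (-ι) l := by
    simpa using! ι.hasFDerivAt.const_sub a
  have h3 := h1.star.mul' h1
  refine (congrArg (fun F : ℂ →L[ℝ] A => F v) h3.fderiv).trans ?_
  simp [hι, Algebra.algebraMap_eq_smul_one]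
  rw [add_comm]

variable [PartialOrder A] [StarOrderedRing A]

theorem contDiffAt_shiftInv {h : A} (hh : 0 ≤ h) {ε : ℝ} (hε : 0 < ε) :
    ContDiffAt ℝ ω (fun y : A => shiftInv y ε) h := by
  obtain ⟨w, hw⟩ := isUnit_shift hh hε
  have h1 := contDiffAt_ringInverse ℝ (n := ω) w
  rw [hw] at h1
  exact h1.comp h (contDiffAt_id.add contDiffAt_const)

theorem mul_shiftInv_star_mul_self {x : A} {ε : ℝ} (hε : 0 < ε) :
    x * shiftInv (star x * x) ε = shiftInv (x * star x) ε * x := by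
  have h1 := shift_mul_shiftInv (star_mul_self_nonneg x) hε
  have h2 := shiftInv_mul_shift (mul_star_self_nonneg x) hε
  calc x * shiftInv (star x * x) ε
      = shiftInv (x * star x) ε * (x * star x + algebraMap ℝ A ε) * x *
        shiftInv (star x * x) ε := by rw [h2, one_mul]
    _ = shiftInv (x * star x) ε * x * ((star x * x + algebraMap ℝ A ε) *
        shiftInv (star x * x) ε) := by
      simp only [mul_add, add_mul, mul_assoc, Algebra.algebraMap_eq_smul_one, smul_mul_assoc,
        mul_smul_comm, one_mul]
    _ = _ := by rw [h1, mul_one]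

end CStarAlgebra

namespace FaithfulNormalTrace

variable {A : Type u} [CStarAlgebra A] [PartialOrder A] [StarOrderedRing A] [WStarAlgebra A]
  (τ : FaithfulNormalTrace A)

/-! ### The regularized logarithmic potential -/

/-- The real part of the trace, as a continuous `ℝ`-linear functional. -/
noncomputable def reTrace : A →L[ℝ] ℝ where
  toFun x := (τ.toPos x).re
  map_add' x y := by simp
  map_smul' r x := by
    rw [← Complex.coe_smul, map_smul]
    simp
  cont := Complex.continuous_re.comp (map_continuous τ.toPos)

theorem reTrace_apply (x : A) : τ.reTrace x = (τ.toPos x).re := rfl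

theorem reTrace_mul_comm (x y : A) : τ.reTrace (x * y) = τ.reTrace (y * x) := by
  rw [reTrace_apply, reTrace_apply, τ.trace]

theorem reTrace_nonneg {x : A} (hx : 0 ≤ x) : 0 ≤ τ.reTrace x :=
  (Complex.le_def.1 (τ.toPos.map_nonneg hx)).1

theorem reTrace_mono {x y : A} (h : x ≤ y) : τ.reTrace x ≤ τ.reTrace y := by
  rw [← sub_nonneg, ← map_sub]
  exact τ.reTrace_nonneg (sub_nonneg.2 h)

theorem reTrace_mul_nonneg {x y : A} (hx : 0 ≤ x) (hy : 0 ≤ y) : 0 ≤ τ.reTrace (x * y) := by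
  obtain ⟨c, rfl⟩ := CStarAlgebra.nonneg_iff_eq_star_mul_self.1 hx
  rw [mul_assoc, reTrace_mul_comm]
  exact τ.reTrace_nonneg (star_right_conjugate_nonneg hy c)

/-- The regularization `½ τ(log (x⋆ x + ε))`, for `x = a - l`, of `log Δ(a - l)`. -/
noncomputable def regLogDet (a : A) (ε : ℝ) (l : ℂ) : ℝ :=
  (1 / 2) * τ.reTrace (CFC.log (star (a - algebraMap ℂ A l) * (a - algebraMap ℂ A l) +
    algebraMap ℝ A ε))

variable (a : A)

/-- The trace of `log (y + ε)` is differentiable on the cone of positive elements, with derivative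
`v ↦ τ((y + ε)⁻¹ v)`. -/
theorem hasFDerivWithinAt_reTrace_log {h : A} (hh : 0 ≤ h) {ε : ℝ} (hε : 0 < ε) :
    HasFDerivWithinAt (fun y : A => τ.reTrace (CFC.log (y + algebraMap ℝ A ε)))
      (τ.reTrace ∘L ContinuousLinearMap.mul ℝ A (shiftInv h ε)) {y | 0 ≤ y} h := by
  rw [hasFDerivWithinAt_iff_isLittleO]
  have key : (fun y : A => τ.reTrace (CFC.log (y + algebraMap ℝ A ε)) -
      τ.reTrace (CFC.log (h + algebraMap ℝ A ε)) -
      (τ.reTrace ∘L ContinuousLinearMap.mul ℝ A (shiftInv h ε)) (y - h))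
      =O[𝓝[{y | 0 ≤ y}] h] fun y => ‖y - h‖ ^ 2 := by
    refine Asymptotics.IsBigO.of_bound (‖τ.reTrace‖ / (2 * ε ^ 2)) ?_
    filter_upwards [self_mem_nhdsWithin] with y hy
    have := abs_trace_log_sub_le τ.reTrace τ.reTrace_mul_comm hh hy hε
    rw [Real.norm_of_nonneg (sq_nonneg ‖y - h‖), div_mul_eq_mul_div]
    exact this
  refine key.trans_isLittleO (Asymptotics.IsLittleO.mono ?_ nhdsWithin_le_nhds)
  exact (Asymptotics.isLittleO_norm_pow_id one_lt_two).comp_tendsto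
    (tendsto_sub_nhds_zero_iff.2 tendsto_id)

theorem hasFDerivAt_regLogDet {ε : ℝ} (hε : 0 < ε) (l : ℂ) :
    HasFDerivAt (τ.regLogDet a ε) ((1 / 2 : ℝ) • ((τ.reTrace ∘L ContinuousLinearMap.mul ℝ A
      (shiftInv (star (a - algebraMap ℂ A l) * (a - algebraMap ℂ A l)) ε)) ∘L
      fderiv ℝ (fun l : ℂ => star (a - algebraMap ℂ A l) * (a - algebraMap ℂ A l)) l)) l := by
  have h1 := (((contDiff_absSq a).differentiable (by simp)) l).hasFDerivAt
  have h2 := (τ.hasFDerivWithinAt_reTrace_log (star_mul_self_nonneg (a - algebraMap ℂ A l))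
    hε).comp_hasFDerivAt l h1 (Eventually.of_forall fun l => star_mul_self_nonneg _)
  exact h2.const_mul (1 / 2)

theorem fderiv_regLogDet {ε : ℝ} (hε : 0 < ε) (l v : ℂ) :
    fderiv ℝ (τ.regLogDet a ε) l v = (1 / 2) * τ.reTrace
      (shiftInv (star (a - algebraMap ℂ A l) * (a - algebraMap ℂ A l)) ε *
      -(v • star (a - algebraMap ℂ A l) + star v • (a - algebraMap ℂ A l))) := by
  rw [(τ.hasFDerivAt_regLogDet a hε l).fderiv, ← fderiv_absSq]
  rfl

theorem contDiff_regLogDet {ε : ℝ} (hε : 0 < ε) : ContDiff ℝ 2 (τ.regLogDet a ε) := by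
  rw [show (2 : WithTop ℕ∞) = 1 + 1 by norm_num, contDiff_succ_iff_fderiv]
  refine ⟨fun l => (τ.hasFDerivAt_regLogDet a hε l).differentiableAt, by simp, ?_⟩
  rw [funext fun l => (τ.hasFDerivAt_regLogDet a hε l).fderiv]
  have h1 : ContDiff ℝ 1 (fun l : ℂ =>
      shiftInv (star (a - algebraMap ℂ A l) * (a - algebraMap ℂ A l)) ε) := by
    rw [contDiff_iff_contDiffAt]
    intro l
    exact ((contDiffAt_shiftInv (star_mul_self_nonneg _) hε).of_le (by simp)).comp l
      ((contDiff_absSq a).of_le (by simp)).contDiffAt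
  have h2 : ContDiff ℝ 1 (fderiv ℝ
      (fun l : ℂ => star (a - algebraMap ℂ A l) * (a - algebraMap ℂ A l))) :=
    ((contDiff_absSq a).of_le (m := 2) (by simp)).fderiv_right (by norm_num)
  exact ((contDiff_const.clm_comp ((ContinuousLinearMap.mul ℝ A).contDiff.comp h1)).clm_comp
    h2).const_smul (1 / 2 : ℝ)

theorem fderiv_fderiv_regLogDet {ε : ℝ} (hε : 0 < ε) (l v : ℂ) :
    fderiv ℝ (fun y => fderiv ℝ (τ.regLogDet a ε) y v) l v =
      ‖v‖ ^ 2 * τ.reTrace (shiftInv (star (a - algebraMap ℂ A l) * (a - algebraMap ℂ A l)) ε) -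
      (1 / 2) * τ.reTrace (shiftInv (star (a - algebraMap ℂ A l) * (a - algebraMap ℂ A l)) ε *
      (v • star (a - algebraMap ℂ A l) + star v • (a - algebraMap ℂ A l)) *
      shiftInv (star (a - algebraMap ℂ A l) * (a - algebraMap ℂ A l)) ε *
      (v • star (a - algebraMap ℂ A l) + star v • (a - algebraMap ℂ A l))) := by
  set ι : ℂ →L[ℝ] A := (Algebra.linearMap ℂ A).toContinuousLinearMap.restrictScalars ℝ with hι
  have h1 : HasFDerivAt (fun l : ℂ => a - algebraMap ℂ A l) (-ι) l := by
    simpa using! ι.hasFDerivAt.const_sub a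
  have h2 : HasFDerivAt (fun l : ℂ => -(v • star (a - algebraMap ℂ A l) +
    star v • (a - algebraMap ℂ A l))) _ l := ((h1.star.const_smul v).add
    (h1.const_smul (star v))).neg
  have h3 := ((contDiff_absSq a).differentiable (by simp) l).hasFDerivAt
  have h4 := (hasFDerivAt_ringInverse_shift (star_mul_self_nonneg (a - algebraMap ℂ A l))
    hε).comp l h3
  have h5 := (τ.reTrace.hasFDerivAt.comp l (h4.mul' h2)).const_mul (1 / 2)
  rw [funext fun y => τ.fderiv_regLogDet a hε y v]
  refine (congrArg (fun F : ℂ →L[ℝ] ℝ => F v) h5.fderiv).trans ?_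
  have h6 := fderiv_absSq a l v
  set x := a - algebraMap ℂ A l with hx
  set P := shiftInv (star x * x) ε with hP
  have hv : v * star v = ((‖v‖ ^ 2 : ℝ) : ℂ) := by
    rw [Complex.star_def, Complex.mul_conj, Complex.normSq_eq_norm_sq]
  have h7 : (-(v • ((starL' ℝ : A ≃L[ℝ] A) : A →L[ℝ] A) ∘L (-ι) + star v • -ι)) v =
      (2 * ‖v‖ ^ 2 : ℝ) • (1 : A) := by
    have h8 : ι v = v • (1 : A) := Algebra.algebraMap_eq_smul_one v
    simp only [_root_.neg_apply, _root_.add_apply, _root_.smul_apply, ContinuousLinearMap.comp_apply, h8]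
    simp only [ContinuousLinearEquiv.coe_coe, starL'_apply, star_neg, star_smul, star_one,
      smul_neg, smul_smul, neg_add, neg_neg, mul_comm (star v) v, hv]
    rw [← Complex.coe_smul, ← add_smul]
    push_cast
    ring_nf
  simp only [_root_.smul_apply, ContinuousLinearMap.comp_apply, _root_.add_apply, h6, h7, Function.comp_apply, _root_.neg_apply,
    ContinuousLinearMap.mulLeftRight_apply, smul_eq_mul, map_add, op_smul_eq_mul]
  rw [← hx, ← hP, mul_smul_comm, mul_one, map_smul, smul_eq_mul, mul_add]
  rw [sub_eq_add_neg]
  congr 1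
  · ring
  · simp only [mul_neg, neg_mul, neg_neg, map_neg]

/-- The Laplacian of the regularized logarithmic potential, in closed form. -/
theorem laplacian_regLogDet {ε : ℝ} (hε : 0 < ε) (l : ℂ) :
    Laplacian.laplacian (τ.regLogDet a ε) l = 2 * ε * τ.reTrace
      (shiftInv (star (a - algebraMap ℂ A l) * (a - algebraMap ℂ A l)) ε *
       shiftInv ((a - algebraMap ℂ A l) * star (a - algebraMap ℂ A l)) ε) := by
  rw [laplacian_eq_fderiv_fderiv (τ.contDiff_regLogDet a hε), τ.fderiv_fderiv_regLogDet a hε,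
    τ.fderiv_fderiv_regLogDet a hε]
  set x := a - algebraMap ℂ A l with hx
  set P := shiftInv (star x * x) ε with hP
  set Q := shiftInv (x * star x) ε with hQ
  -- The terms with `x P x` and `x⋆ P x⋆` cancel.
  have h1 : P * ((1 : ℂ) • star x + star (1 : ℂ) • x) * P * ((1 : ℂ) • star x + star (1 : ℂ) • x) +
      P * (Complex.I • star x + star Complex.I • x) * P *
        (Complex.I • star x + star Complex.I • x) =
      (2 : ℝ) • (P * star x * (P * x)) + (2 : ℝ) • (P * x * (P * star x)) := by
    simp only [star_one, one_smul, Complex.star_def, Complex.conj_I, neg_smul, mul_add, add_mul,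
      mul_neg, neg_mul, mul_smul_comm, smul_mul_assoc, smul_add, smul_neg, smul_smul,
      Complex.I_mul_I, neg_neg, two_smul, mul_assoc]
    abel
  have h2 : τ.reTrace (P * star x * (P * x)) = τ.reTrace (P * x * (P * star x)) :=
    τ.reTrace_mul_comm _ _
  have h3 : x * P * star x = 1 - ε • Q := by
    rw [hP, mul_shiftInv_star_mul_self hε, hQ]
    have := shiftInv_mul_shift (mul_star_self_nonneg x) hε
    rw [mul_add, Algebra.algebraMap_eq_smul_one, mul_smul_comm, mul_one] at this
    rw [← this, mul_assoc, add_sub_cancel_right]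
  have h4 : τ.reTrace (P * x * (P * star x)) = τ.reTrace P - ε * τ.reTrace (P * Q) := by
    rw [mul_assoc, ← mul_assoc x, h3, mul_sub, mul_one, mul_smul_comm, map_sub, map_smul,
      smul_eq_mul]
  have h5 := congrArg τ.reTrace h1
  simp only [map_add, map_smul, smul_eq_mul, h2, h4] at h5
  simp only [norm_one, Complex.norm_I]
  linarith

theorem laplacian_regLogDet_nonneg {ε : ℝ} (hε : 0 < ε) (l : ℂ) :
    0 ≤ Laplacian.laplacian (τ.regLogDet a ε) l := by
  rw [τ.laplacian_regLogDet a hε]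
  have := τ.reTrace_mul_nonneg
    (shiftInv_nonneg (star_mul_self_nonneg (a - algebraMap ℂ A l)) hε)
    (shiftInv_nonneg (mul_star_self_nonneg (a - algebraMap ℂ A l)) hε)
  positivity

theorem regLogDet_mono {ε δ : ℝ} (hε : 0 < ε) (h : ε ≤ δ) (l : ℂ) :
    τ.regLogDet a ε l ≤ τ.regLogDet a δ l := by
  refine mul_le_mul_of_nonneg_left (τ.reTrace_mono ?_) (by norm_num)
  refine CFC.log_le_log ?_ (isStrictlyPositive_shift (star_mul_self_nonneg _) hε)
  gcongr

theorem regLogDet_nonneg {ε : ℝ} (hε : 0 < ε) {l : ℂ} (hl : 2 * ‖a‖ + 1 ≤ ‖l‖) :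
    0 ≤ τ.regLogDet a ε l := by
  have h1 : star (l • star a + star l • a) = l • star a + star l • a := by
    simp [add_comm]
  have h2 := IsSelfAdjoint.le_algebraMap_norm_self (a := l • star a + star l • a) h1
  have h3 : ‖l • star a + star l • a‖ ≤ 2 * ‖l‖ * ‖a‖ := by
    refine (norm_add_le _ _).trans ?_
    rw [norm_smul, norm_smul, norm_star, norm_star]
    linarith
  have h4 : (1 : A) ≤ star (a - algebraMap ℂ A l) * (a - algebraMap ℂ A l) := by
    have e : star (a - algebraMap ℂ A l) * (a - algebraMap ℂ A l) =
        star a * a + (algebraMap ℝ A (‖l‖ ^ 2) - (l • star a + star l • a)) := by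
      have : algebraMap ℝ A (‖l‖ ^ 2) = (star l * l) • (1 : A) := by
        rw [Algebra.algebraMap_eq_smul_one, ← Complex.coe_smul, Complex.star_def,
          Complex.conj_mul']
        push_cast
        rfl
      rw [this]
      simp only [Algebra.algebraMap_eq_smul_one, star_sub, star_smul, star_one, sub_mul, mul_sub,
        mul_smul_comm, smul_mul_assoc, mul_one, one_mul, smul_smul, smul_sub, mul_comm (star l) l]
      abel
    rw [e]
    have h5 : algebraMap ℝ A 1 ≤ algebraMap ℝ A (‖l‖ ^ 2) - (l • star a + star l • a) := by
      refine le_trans ?_ (sub_le_sub_left h2 _)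
      rw [← map_sub]
      refine algebraMap_mono A ?_
      nlinarith [norm_nonneg a]
    rw [_root_.map_one] at h5
    exact h5.trans (le_add_of_nonneg_left (star_mul_self_nonneg a))
  have h6 : (1 : A) ≤ star (a - algebraMap ℂ A l) * (a - algebraMap ℂ A l) + algebraMap ℝ A ε :=
    h4.trans (le_add_of_nonneg_right (algebraMap_nonneg A hε.le))
  have h7 := CFC.log_le_log h6 isStrictlyPositive_one
  rw [CFC.log_one] at h7
  exact mul_nonneg (by norm_num) (τ.reTrace_nonneg h7)

end FaithfulNormalTrace

namespace FaithfulNormalTrace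

variable {A : Type u} [CStarAlgebra A] [PartialOrder A] [StarOrderedRing A] [WStarAlgebra A]
  (τ : FaithfulNormalTrace A)

/-! ### Left and right multiplication on `L²` -/

theorem denseRange_toL2 : DenseRange τ.toL2 :=
  Completion.denseRange_coe (α := τ.toPos.PreGNS)

theorem toL2_sub (x y : A) : τ.toL2 (x - y) = τ.toL2 x - τ.toL2 y := by
  simp only [toL2, map_sub, Completion.coe_sub]

theorem inner_toL2 (x y : A) : inner ℂ (τ.toL2 x) (τ.toL2 y) = τ.toPos (star x * y) := by
  simp [toL2, PositiveLinearMap.preGNS_inner_def]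

theorem norm_toL2_sq (x : A) : ((‖τ.toL2 x‖ ^ 2 : ℝ) : ℂ) = τ.toPos (star x * x) := by
  rw [← inner_toL2, inner_self_eq_norm_sq_to_K]
  simp

theorem norm_toL2_star (x : A) : ‖τ.toL2 (star x)‖ = ‖τ.toL2 x‖ := by
  rw [← sq_eq_sq₀ (norm_nonneg _) (norm_nonneg _), ← Complex.ofReal_inj, norm_toL2_sq,
    norm_toL2_sq, star_star, τ.trace]

theorem continuous_toL2 : Continuous τ.toL2 := by
  have h : Continuous fun x : A => τ.toPos.gnsStarAlgHom x (τ.toL2 1) := by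
    have h2 : Continuous τ.toPos.gnsStarAlgHom := map_continuous _
    exact (ContinuousLinearMap.apply ℂ τ.L2 (τ.toL2 1)).continuous.comp h2
  convert h using 2 with x
  have := τ.leftMul_toL2 x 1
  rw [mul_one] at this
  exact this.symm

theorem norm_leftMul_apply_le (x : A) (ξ : τ.L2) : ‖τ.leftMul x ξ‖ ≤ ‖x‖ * ‖ξ‖ := by
  induction ξ using Completion.induction_on with
  | hp => exact isClosed_le (by fun_prop) (by fun_prop)
  | ih y =>
    rw [leftMul, ContinuousLinearMap.completion_apply_coe, Completion.norm_coe,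
      Completion.norm_coe]
    exact ContinuousLinearMap.le_of_opNorm_le _
      (LinearMap.mkContinuous_norm_le _ (norm_nonneg x) _) y

theorem norm_rightMul_apply_le (x : A) (ξ : τ.L2) : ‖τ.rightMul x ξ‖ ≤ ‖x‖ * ‖ξ‖ := by
  induction ξ using Completion.induction_on with
  | hp => exact isClosed_le (by fun_prop) (by fun_prop)
  | ih y =>
    rw [rightMul, ContinuousLinearMap.completion_apply_coe, Completion.norm_coe,
      Completion.norm_coe]
    exact ContinuousLinearMap.le_of_opNorm_le _
      (LinearMap.mkContinuous_norm_le _ (norm_nonneg x) _) y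

theorem leftMul_leftMul (x y : A) (ξ : τ.L2) :
    τ.leftMul x (τ.leftMul y ξ) = τ.leftMul (x * y) ξ := by
  refine τ.denseRange_toL2.induction_on ξ (isClosed_eq (by fun_prop) (by fun_prop)) fun z => ?_
  simp only [leftMul_toL2, mul_assoc]

theorem rightMul_rightMul (x y : A) (ξ : τ.L2) :
    τ.rightMul x (τ.rightMul y ξ) = τ.rightMul (y * x) ξ := by
  refine τ.denseRange_toL2.induction_on ξ (isClosed_eq (by fun_prop) (by fun_prop)) fun z => ?_
  simp only [rightMul_toL2, mul_assoc]

theorem leftMul_rightMul (x y : A) (ξ : τ.L2) :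
    τ.leftMul x (τ.rightMul y ξ) = τ.rightMul y (τ.leftMul x ξ) := by
  refine τ.denseRange_toL2.induction_on ξ (isClosed_eq (by fun_prop) (by fun_prop)) fun z => ?_
  simp only [rightMul_toL2, leftMul_toL2, mul_assoc]

theorem inner_leftMul (x : A) (ξ η : τ.L2) :
    inner ℂ (τ.leftMul x ξ) η = inner ℂ ξ (τ.leftMul (star x) η) := by
  refine τ.denseRange_toL2.induction_on₂ (isClosed_eq (by fun_prop) (by fun_prop)) ?_ ξ η
  intro y z
  simp only [leftMul_toL2, inner_toL2, star_mul, mul_assoc]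

theorem inner_rightMul (x : A) (ξ η : τ.L2) :
    inner ℂ (τ.rightMul x ξ) η = inner ℂ ξ (τ.rightMul (star x) η) := by
  refine τ.denseRange_toL2.induction_on₂ (isClosed_eq (by fun_prop) (by fun_prop)) ?_ ξ η
  intro y z
  simp only [rightMul_toL2, inner_toL2, star_mul]
  rw [mul_assoc, τ.trace, mul_assoc]

/-- An element of `A` with a left inverse in `L²` acts injectively by left multiplication. Indeed
`b z = 1` gives `z⋆ b⋆ = 1` up to approximation of `b` by elements of `A`, so that multiplication by
`z⋆`, the adjoint, has dense range. This is where the trace property makes the two sides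
interchangeable. -/
theorem leftMul_injective_of_rightMul_eq {z : A} {b : τ.L2} (hb : τ.rightMul z b = τ.toL2 1)
    {ξ : τ.L2} (hξ : τ.leftMul z ξ = 0) : ξ = 0 := by
  have key : ∀ y : A, inner ℂ (τ.toL2 y) ξ = 0 := by
    intro y
    rw [← norm_le_zero_iff]
    refine le_of_forall_pos_le_add fun ε hε => ?_
    set M := ‖y‖ * ‖ξ‖ + 1 with hM
    have hM0 : 0 < M := by positivity
    have hc : ∀ᶠ w in 𝓝 b, ‖τ.rightMul z w - τ.toL2 1‖ < ε / M := by
      have : Tendsto (fun w => ‖τ.rightMul z w - τ.toL2 1‖) (𝓝 b) (𝓝 0) := by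
        have h1 : Continuous fun w => ‖τ.rightMul z w - τ.toL2 1‖ := by fun_prop
        simpa [hb] using h1.tendsto b
      exact this.eventually_lt_const (by positivity)
    obtain ⟨c, hc⟩ := τ.denseRange_toL2.exists_mem_open isOpen_interior
      ⟨b, mem_interior_iff_mem_nhds.2 hc⟩
    replace hc : ‖τ.rightMul z (τ.toL2 c) - τ.toL2 1‖ < ε / M := by
      simpa using! interior_subset hc
    rw [rightMul_toL2, ← toL2_sub, ← norm_toL2_star] at hc
    have h0 : inner ℂ (τ.toL2 (star (c * z) * y)) ξ = 0 := by
      rw [star_mul, mul_assoc, ← leftMul_toL2, inner_leftMul, star_star, hξ, inner_zero_right]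
    have h1 : inner ℂ (τ.toL2 y) ξ =
        -inner ℂ (τ.rightMul y (τ.toL2 (star (c * z - 1)))) ξ := by
      rw [rightMul_toL2, star_sub, star_one, sub_mul, one_mul, toL2_sub, inner_sub_left, h0]
      simp
    rw [h1, norm_neg, zero_add]
    calc _ ≤ (‖y‖ * (ε / M)) * ‖ξ‖ := by
          refine (norm_inner_le_norm _ _).trans ?_
          gcongr
          refine (τ.norm_rightMul_apply_le _ _).trans ?_
          gcongr
      _ = (‖y‖ * ‖ξ‖) / M * ε := by ring
      _ ≤ 1 * ε := by
          gcongr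
          rw [div_le_one hM0, hM]
          linarith
      _ = ε := one_mul ε
  have h2 : inner ℂ ξ ξ = 0 := by
    refine τ.denseRange_toL2.induction_on (p := fun η => inner ℂ η ξ = 0) ξ
      (isClosed_eq (by fun_prop) (by fun_prop)) key
  exact inner_self_eq_zero.1 h2

/-- If `b` is an inverse of `x ^ 2` in `L²`, then `x b x = 1`. -/
theorem IsL2Inverse.rightMul_leftMul {x : A} {b : τ.L2} (hb : τ.IsL2Inverse (x ^ 2) b) :
    τ.rightMul x (τ.leftMul x b) = τ.toL2 1 := by
  rw [← sub_eq_zero]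
  refine τ.leftMul_injective_of_rightMul_eq hb.2 ?_
  rw [map_sub, leftMul_rightMul, leftMul_leftMul, leftMul_toL2, ← pow_succ, pow_succ',
    ← leftMul_leftMul, hb.1, leftMul_toL2, rightMul_toL2, sub_eq_zero]
  congr 1
  rw [mul_one, mul_one, sq]

/-- The key estimate: an inverse of `x ^ 2` in `L²` controls the trace of
`(x⋆ x + ε)⁻¹ (x x⋆ + ε)⁻¹` uniformly in `ε`. Formally this is monotonicity, as
`τ((x⋆ x)⁻¹ (x x⋆)⁻¹) = ‖x⁻²‖₂ ^ 2`. -/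
theorem reTrace_shiftInv_mul_shiftInv_le {x : A} {b : τ.L2} (hb : τ.IsL2Inverse (x ^ 2) b) {ε : ℝ}
    (hε : 0 < ε) :
    τ.reTrace (shiftInv (star x * x) ε * shiftInv (x * star x) ε) ≤ ‖b‖ ^ 2 := by
  set P := shiftInv (star x * x) ε with hP
  set Q := shiftInv (x * star x) ε with hQ
  have h1 := IsL2Inverse.rightMul_leftMul τ hb
  have hx : x * P = Q * x := mul_shiftInv_star_mul_self hε
  have hx' : star x * Q = P * star x := by
    have := mul_shiftInv_star_mul_self (x := star x) hε
    rwa [star_star] at this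
  -- Substitute `1 = x b x` for both unit vectors in `τ(Q P) = ⟨1, Q 1 P⟩`.
  have e : (τ.toPos (Q * P)) =
      inner ℂ b (τ.leftMul (star x * Q * x) (τ.rightMul (x * P * star x) b)) := by
    have : τ.toPos (Q * P) = inner ℂ (τ.toL2 1) (τ.leftMul Q (τ.rightMul P (τ.toL2 1))) := by
      rw [rightMul_toL2, leftMul_toL2, inner_toL2]
      simp
    rw [this, ← h1, inner_rightMul, inner_leftMul, ← leftMul_rightMul, leftMul_leftMul,
      rightMul_rightMul, leftMul_rightMul, leftMul_rightMul, rightMul_rightMul, leftMul_leftMul,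
      ← leftMul_rightMul, ← mul_assoc x]
  have n1 : ‖star x * Q * x‖ ≤ 1 := by
    rw [hx', mul_assoc]
    exact norm_shiftInv_mul_self_le (star_mul_self_nonneg x) hε
  have n2 : ‖x * P * star x‖ ≤ 1 := by
    rw [hx, mul_assoc]
    exact norm_shiftInv_mul_self_le (mul_star_self_nonneg x) hε
  rw [reTrace_mul_comm, reTrace_apply, e]
  calc _ ≤ ‖b‖ * (1 * (1 * ‖b‖)) := by
        refine (Complex.re_le_norm _).trans ((norm_inner_le_norm _ _).trans ?_)
        gcongr
        refine (τ.norm_leftMul_apply_le _ _).trans ?_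
        gcongr
        refine (τ.norm_rightMul_apply_le _ _).trans ?_
        gcongr
    _ = _ := by ring

/-! ### The spectrum contains the `L²₂`-spectrum -/

theorem l2Spectrum_subset_spectrum (n : ℕ) (a : A) : τ.l2Spectrum n a ⊆ spectrum ℂ a := by
  rw [l2Spectrum, Set.compl_subset_comm]
  intro l hl
  have hl : IsUnit (algebraMap ℂ A l - a) := by
    simpa [spectrum, resolventSet] using hl
  have hl : IsUnit (a - algebraMap ℂ A l) := by
    rw [← neg_sub]
    exact hl.neg
  set f : ℂ → A := fun z => a - algebraMap ℂ A z with hf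
  have hfc : Continuous f := continuous_const.sub (continuous_algebraMap ℂ A)
  have hinv : ContinuousAt (fun z => τ.toL2 (Ring.inverse (f z) ^ n)) l := by
    obtain ⟨w, hw⟩ := hl
    have h1 : ContinuousAt Ring.inverse (f l) := by
      rw [show f l = ↑w from hw.symm]
      exact NormedRing.inverse_continuousAt w
    exact τ.continuous_toL2.continuousAt.comp
      ((ContinuousAt.comp (f := f) h1 hfc.continuousAt).pow n)
  refine ⟨‖τ.toL2 (Ring.inverse (f l) ^ n)‖ + 1, ?_⟩
  have hu : ∀ᶠ z in 𝓝 l, IsUnit (f z) :=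
    hfc.continuousAt.eventually (Units.isOpen.mem_nhds hl)
  filter_upwards [hu, hinv.norm.eventually_lt_const (lt_add_one _)] with z hz hz'
  have hcomm : Commute (Ring.inverse (f z)) (f z) := by
    rw [commute_iff_eq, Ring.inverse_mul_cancel _ hz, Ring.mul_inverse_cancel _ hz]
  refine ⟨_, ⟨?_, ?_⟩, hz'.le⟩
  · rw [leftMul_toL2, ← hcomm.symm.mul_pow, Ring.mul_inverse_cancel _ hz, one_pow]
  · rw [rightMul_toL2, ← hcomm.mul_pow, Ring.inverse_mul_cancel _ hz, one_pow]

end FaithfulNormalTrace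

/-! ### Integration by parts -/

theorem contDiff_fderiv_apply {f : ℂ → ℝ} (hf : ContDiff ℝ 2 f) (v : ℂ) :
    ContDiff ℝ 1 fun l => fderiv ℝ f l v :=
  (hf.fderiv_right (m := 1) (by norm_num)).clm_apply contDiff_const

theorem continuous_laplacian {f : ℂ → ℝ} (hf : ContDiff ℝ 2 f) :
    Continuous (Laplacian.laplacian f) := by
  rw [funext (laplacian_eq_fderiv_fderiv hf)]
  have h (v : ℂ) : Continuous fun l => fderiv ℝ (fun y => fderiv ℝ f y v) l v :=
    ((contDiff_fderiv_apply hf v).continuous_fderiv (by norm_num)).clm_apply continuous_const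
  exact (h 1).add (h Complex.I)

theorem hasCompactSupport_laplacian {f : ℂ → ℝ} (hf : ContDiff ℝ 2 f) (hc : HasCompactSupport f) :
    HasCompactSupport (Laplacian.laplacian f) := by
  rw [funext (laplacian_eq_fderiv_fderiv hf)]
  exact ((hc.fderiv_apply ℝ 1).fderiv_apply ℝ 1).add
    ((hc.fderiv_apply ℝ Complex.I).fderiv_apply ℝ Complex.I)

theorem integral_mul_laplacian {f φ : ℂ → ℝ} (hf : ContDiff ℝ 2 f) (hφ : ContDiff ℝ 2 φ)
    (hc : HasCompactSupport φ) :
    ∫ l, f l * Laplacian.laplacian φ l = ∫ l, Laplacian.laplacian f l * φ l := by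
  have hfd (v : ℂ) := contDiff_fderiv_apply hf v
  have hφd (v : ℂ) := contDiff_fderiv_apply hφ v
  have hfdd (v : ℂ) : Continuous fun l => fderiv ℝ (fun y => fderiv ℝ f y v) l v :=
    ((hfd v).continuous_fderiv (by norm_num)).clm_apply continuous_const
  have hφdd (v : ℂ) : Continuous fun l => fderiv ℝ (fun y => fderiv ℝ φ y v) l v :=
    ((hφd v).continuous_fderiv (by norm_num)).clm_apply continuous_const
  have hcd (v : ℂ) := hc.fderiv_apply ℝ v
  have i1 (v : ℂ) : Integrable fun l => f l * fderiv ℝ (fun y => fderiv ℝ φ y v) l v :=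
    (hf.continuous.mul (hφdd v)).integrable_of_hasCompactSupport
      (((hcd v).fderiv_apply ℝ v).mul_left)
  have i2 (v : ℂ) : Integrable fun l => fderiv ℝ (fun y => fderiv ℝ f y v) l v * φ l :=
    ((hfdd v).mul hφ.continuous).integrable_of_hasCompactSupport hc.mul_left
  have i3 (v : ℂ) : Integrable fun l => fderiv ℝ f l v * fderiv ℝ φ l v :=
    ((hfd v).continuous.mul (hφd v).continuous).integrable_of_hasCompactSupport (hcd v).mul_left
  have i4 (v : ℂ) : Integrable fun l => f l * fderiv ℝ φ l v :=
    (hf.continuous.mul (hφd v).continuous).integrable_of_hasCompactSupport (hcd v).mul_left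
  have i5 (v : ℂ) : Integrable fun l => fderiv ℝ f l v * φ l :=
    ((hfd v).continuous.mul hφ.continuous).integrable_of_hasCompactSupport hc.mul_left
  have key (v : ℂ) : ∫ l, f l * fderiv ℝ (fun y => fderiv ℝ φ y v) l v =
      ∫ l, fderiv ℝ (fun y => fderiv ℝ f y v) l v * φ l := by
    rw [integral_mul_fderiv_eq_neg_fderiv_mul_of_integrable (i3 v) (i1 v) (i4 v)
      (fun l _ => hf.differentiable (by norm_num) l)
      (fun l _ => (hφd v).differentiable (by norm_num) l),
      integral_mul_fderiv_eq_neg_fderiv_mul_of_integrable (i2 v) (i3 v) (i5 v)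
      (fun l _ => (hfd v).differentiable (by norm_num) l)
      (fun l _ => hφ.differentiable (by norm_num) l), neg_neg]
  simp only [laplacian_eq_fderiv_fderiv hf, laplacian_eq_fderiv_fderiv hφ, mul_add, add_mul]
  rw [integral_add (i1 1) (i1 _), integral_add (i2 1) (i2 _), key, key]

/-! ### Measures are determined by smooth test functions -/

/-- Two locally finite measures on the plane which agree on smooth functions with compact support
are equal: the indicator function of a bounded open set is an increasing limit of such functions. -/
theorem measure_ext_of_integral_contDiff {μ ν : Measure ℂ} [IsLocallyFiniteMeasure μ]
    [IsLocallyFiniteMeasure ν]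
    (h : ∀ φ : ℂ → ℝ, ContDiff ℝ ∞ φ → HasCompactSupport φ → ∫ l, φ l ∂μ = ∫ l, φ l ∂ν) :
    μ = ν := by
  have key : ∀ U : Set ℂ, IsOpen U → Bornology.IsBounded U → μ U = ν U := by
    intro U hU hb
    obtain ⟨f, hf1, hf2, hf3⟩ := hU.exists_contDiff_support_eq (n := ⊤)
    have hf0 : ∀ l, 0 ≤ f l := fun l => (hf3 ⟨l, rfl⟩).1
    set g : ℕ → ℂ → ℝ := fun n l => Real.smoothTransition (n * f l) with hg
    have hgs : ∀ n, ContDiff ℝ ∞ (g n) := fun n =>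
      Real.smoothTransition.contDiff.comp (contDiff_const.mul hf2)
    have hg0 : ∀ n, ∀ l ∉ U, g n l = 0 := by
      intro n l hl
      rw [← hf1, Function.notMem_support] at hl
      simp [hg, hl]
    have hgc : ∀ n, HasCompactSupport (g n) := fun n =>
      HasCompactSupport.of_support_subset_isCompact hb.isCompact_closure fun l hl =>
        subset_closure (by by_contra hlU; exact hl (hg0 n l hlU))
    have hlim : ∀ (ρ : Measure ℂ) [IsLocallyFiniteMeasure ρ],
        Tendsto (fun n => ∫ l, g n l ∂ρ) atTop (𝓝 (ρ.real U)) := by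
      intro ρ _
      rw [← integral_indicator_one hU.measurableSet]
      have hfin : ρ U ≠ ⊤ :=
        ((measure_mono subset_closure).trans_lt hb.isCompact_closure.measure_lt_top).ne
      refine tendsto_integral_of_dominated_convergence (U.indicator 1)
        (fun n => (hgs n).continuous.aestronglyMeasurable)
        ((integrable_indicator_iff hU.measurableSet).2 (integrableOn_const hfin)) ?_ ?_
      · refine fun n => Eventually.of_forall fun l => ?_
        by_cases hl : l ∈ U
        · rw [Set.indicator_of_mem hl, Real.norm_of_nonneg (Real.smoothTransition.nonneg _)]
          exact Real.smoothTransition.le_one _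
        · rw [hg0 n l hl, Set.indicator_of_notMem hl, norm_zero]
      · refine Eventually.of_forall fun l => ?_
        by_cases hl : l ∈ U
        · rw [Set.indicator_of_mem hl]
          have hfl : 0 < f l := by
            rw [← hf1] at hl
            exact lt_of_le_of_ne (hf0 l) (Ne.symm hl)
          refine tendsto_const_nhds.congr' ?_
          filter_upwards [(tendsto_natCast_atTop_atTop.atTop_mul_const hfl).eventually_ge_atTop 1]
            with n hn
          exact (Real.smoothTransition.one_of_one_le hn).symm
        · rw [Set.indicator_of_notMem hl]
          simp [hg0 _ l hl]
    have e := tendsto_nhds_unique (hlim μ) ((hlim ν).congr fun n => (h _ (hgs n) (hgc n)).symm)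
    rwa [measureReal_def, measureReal_def, ENNReal.toReal_eq_toReal_iff'] at e
    · exact ((measure_mono subset_closure).trans_lt hb.isCompact_closure.measure_lt_top).ne
    · exact ((measure_mono subset_closure).trans_lt hb.isCompact_closure.measure_lt_top).ne
  refine Measure.ext_of_generateFrom_of_cover (S := {U | IsOpen U})
    (T := Set.range fun n : ℕ => Metric.ball (0 : ℂ) n) (BorelSpace.measurable_eq)
    (Set.countable_range _) isPiSystem_isOpen ?_ ?_ ?_ ?_
  · rw [Set.sUnion_range]
    exact Metric.iUnion_ball_nat 0
  · rintro _ ⟨n, rfl⟩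
    exact measure_ball_lt_top.ne
  · rintro _ ⟨n, rfl⟩ s hs
    exact key _ (IsOpen.inter hs Metric.isOpen_ball) (Metric.isBounded_ball.subset
      Set.inter_subset_right)
  · rintro _ ⟨n, rfl⟩
    exact key _ Metric.isOpen_ball Metric.isBounded_ball

/-! ### A lower bound for integrals of subharmonic functions -/

theorem hasDerivAt_max_zero_pow (n : ℕ) (t : ℝ) :
    HasDerivAt (fun s : ℝ => max s 0 ^ (n + 2)) ((n + 2) * max t 0 ^ (n + 1)) t := by
  rcases lt_trichotomy t 0 with ht | rfl | ht
  · rw [max_eq_right ht.le]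
    have : HasDerivAt (fun _ : ℝ => (0 : ℝ)) 0 t := hasDerivAt_const t 0
    simp only [ne_eq, Nat.add_eq_zero_iff, one_ne_zero, and_false, not_false_eq_true, zero_pow,
      mul_zero]
    refine this.congr_of_eventuallyEq ?_
    filter_upwards [eventually_lt_nhds ht] with s hs
    simp [max_eq_right hs.le]
  · rw [hasDerivAt_iff_isLittleO]
    simp only [max_self, ne_eq, Nat.add_eq_zero_iff, one_ne_zero, and_false, not_false_eq_true,
      zero_pow, mul_zero, smul_zero, sub_zero, OfNat.ofNat_ne_zero]
    have h1 : (fun s : ℝ => max s 0 ^ (n + 2)) =O[𝓝 0] fun s : ℝ => s ^ (n + 2) := by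
      refine Asymptotics.IsBigO.of_bound 1 (Eventually.of_forall fun s => ?_)
      rw [norm_pow, norm_pow, one_mul]
      gcongr
      rw [Real.norm_of_nonneg (le_max_right _ _)]
      exact max_le (le_abs_self s) (abs_nonneg s)
    exact h1.trans_isLittleO (Asymptotics.isLittleO_pow_id (by omega))
  · rw [max_eq_left ht.le]
    have h1 := hasDerivAt_pow (n + 2) t
    push_cast at h1
    refine h1.congr_of_eventuallyEq ?_
    filter_upwards [eventually_gt_nhds ht] with s hs
    simp [max_eq_left (le_of_lt hs)]

theorem contDiff_max_zero_pow (n : ℕ) : ContDiff ℝ 2 fun s : ℝ => max s 0 ^ (n + 3) := by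
  have d1 : deriv (fun s : ℝ => max s 0 ^ (n + 3)) =
      fun t : ℝ => ((n : ℝ) + 1 + 2) * max t 0 ^ (n + 2) := by
    funext t
    have := (hasDerivAt_max_zero_pow (n + 1) t).deriv
    push_cast at this
    exact this
  have c1 : ContDiff ℝ 1 fun s : ℝ => max s 0 ^ (n + 2) := by
    rw [contDiff_one_iff_deriv]
    refine ⟨fun t => (hasDerivAt_max_zero_pow n t).differentiableAt, ?_⟩
    rw [funext fun t => (hasDerivAt_max_zero_pow n t).deriv]
    fun_prop
  rw [show (2 : WithTop ℕ∞) = 1 + 1 by norm_num, contDiff_succ_iff_deriv]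
  refine ⟨fun t => (hasDerivAt_max_zero_pow (n + 1) t).differentiableAt, by simp, ?_⟩
  rw [d1]
  exact contDiff_const.mul c1

/-- The radial test function `max (c - ‖l - z‖², 0) ^ (n + 3)`. -/
noncomputable def radialTest (z : ℂ) (c : ℝ) (n : ℕ) (l : ℂ) : ℝ :=
  max (c - ‖l - z‖ ^ 2) 0 ^ (n + 3)

theorem contDiff_radialTest (z : ℂ) (c : ℝ) (n : ℕ) : ContDiff ℝ 2 (radialTest z c n) :=
  (contDiff_max_zero_pow n).comp
    (contDiff_const.sub ((contDiff_id.sub contDiff_const).norm_sq ℝ))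

theorem laplacian_radialTest (z : ℂ) (c : ℝ) (n : ℕ) (l : ℂ) :
    Laplacian.laplacian (radialTest z c n) l = 4 * (n + 3) * max (c - ‖l - z‖ ^ 2) 0 ^ (n + 1) *
      ((n + 2) * ‖l - z‖ ^ 2 - max (c - ‖l - z‖ ^ 2) 0) := by
  have hq : ∀ y : ℂ, HasFDerivAt (fun y : ℂ => c - ‖y - z‖ ^ 2)
      (-((2 : ℝ) • (innerSL ℝ (y - z)) ∘L ContinuousLinearMap.id ℝ ℂ)) y := by
    intro y
    have := ((hasFDerivAt_id (𝕜 := ℝ) y).sub_const z).norm_sq.const_sub c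
    simpa [two_smul] using! this
  have h1 : ∀ y v : ℂ, fderiv ℝ (radialTest z c n) y v =
      ((n + 3) * max (c - ‖y - z‖ ^ 2) 0 ^ (n + 2)) * (-2 * inner ℝ (y - z) v) := by
    intro y v
    have h := (hasDerivAt_max_zero_pow (n + 1) (c - ‖y - z‖ ^ 2)).comp_hasFDerivAt y (hq y)
    refine (congrArg (fun F : ℂ →L[ℝ] ℝ => F v) h.fderiv).trans ?_
    simp
    ring
  have h2 : ∀ v : ℂ, fderiv ℝ (fun y => fderiv ℝ (radialTest z c n) y v) l v =
      (n + 3) * (n + 2) * max (c - ‖l - z‖ ^ 2) 0 ^ (n + 1) * (4 * inner ℝ (l - z) v ^ 2) -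
      (n + 3) * max (c - ‖l - z‖ ^ 2) 0 ^ (n + 2) * (2 * ‖v‖ ^ 2) := by
    intro v
    rw [funext fun y => h1 y v]
    have h := ((hasDerivAt_max_zero_pow n (c - ‖l - z‖ ^ 2)).comp_hasFDerivAt l (hq l)).const_mul
      ((n : ℝ) + 3)
    have h' : HasFDerivAt (fun y : ℂ => -2 * inner ℝ (y - z) v) _ l :=
      (((hasFDerivAt_id (𝕜 := ℝ) l).sub_const z).inner ℝ (hasFDerivAt_const v l)).const_mul (-2)
    refine (congrArg (fun F : ℂ →L[ℝ] ℝ => F v) (h.mul h').fderiv).trans ?_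
    simp [fderivInnerCLM_apply]
    ring
  rw [laplacian_eq_fderiv_fderiv (contDiff_radialTest z c n), h2, h2]
  have h3 : (‖l - z‖ ^ 2) = inner ℝ (l - z) 1 ^ 2 + inner ℝ (l - z) Complex.I ^ 2 := by
    rw [← Complex.normSq_eq_norm_sq, Complex.normSq_apply]
    simp [Complex.inner]
    ring
  generalize max (c - ‖l - z‖ ^ 2) 0 = m
  simp only [norm_one, Complex.norm_I, h3]
  ring

theorem support_radialTest_subset (z : ℂ) {R : ℝ} (hR : 0 ≤ R) (n : ℕ) :
    Function.support (radialTest z (R ^ 2) n) ⊆ Metric.closedBall z R := by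
  intro l hl
  by_contra h
  rw [Metric.mem_closedBall, dist_eq_norm, not_le] at h
  refine hl ?_
  have : R ^ 2 - ‖l - z‖ ^ 2 ≤ 0 := by nlinarith
  simp [radialTest, max_eq_right this]

/-- A subharmonic function which is at most `M` on a large disc and nonnegative on the disc of
radius `1` with the same centre has an integral over the large disc which is bounded below in terms
of `M` and the radii only. This is a form of the sub-mean value inequality; it comes from
integrating against a test function whose Laplacian is at least `1` between the two radii. -/
theorem exists_setIntegral_sub_le (z : ℂ) {R : ℝ} (hR : 1 ≤ R) :
    ∃ K : ℝ, ∀ (f : ℂ → ℝ) (M : ℝ), ContDiff ℝ 2 f → (∀ l, 0 ≤ Laplacian.laplacian f l) → 0 ≤ M →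
      (∀ l ∈ Metric.closedBall z (R + 1), f l ≤ M) → (∀ l ∈ Metric.closedBall z 1, 0 ≤ f l) →
      ∫ l in Metric.closedBall z R, (M - f l) ≤ M * K := by
  -- The sign of `∇² φ` is that of `(n + 2) ‖l - z‖² - max (c - ‖l - z‖², 0)`, where `c = (R + 1)²`;
  -- for `‖l - z‖ ≥ 1` and `n ≥ c` this is at least `1`.
  obtain ⟨n, hn⟩ := exists_nat_ge ((R + 1) ^ 2)
  set φ := radialTest z ((R + 1) ^ 2) n with hφ
  have hφs : ContDiff ℝ 2 φ := contDiff_radialTest _ _ _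
  have hsupp : Function.support φ ⊆ Metric.closedBall z (R + 1) :=
    support_radialTest_subset z (by linarith) n
  have hφc : HasCompactSupport φ :=
    HasCompactSupport.of_support_subset_isCompact (isCompact_closedBall z (R + 1)) hsupp
  have hφ0 : ∀ l, 0 ≤ φ l := fun l => pow_nonneg (le_max_right _ _) _
  have hLc := continuous_laplacian hφs
  have hLs := hasCompactSupport_laplacian hφs hφc
  obtain ⟨B, hB⟩ := hLc.bounded_above_of_compact_support hLs
  have hB0 : 0 ≤ B := (norm_nonneg _).trans (hB 0)
  have hL : ∀ l, Laplacian.laplacian φ l = 4 * (n + 3) * max ((R + 1) ^ 2 - ‖l - z‖ ^ 2) 0 ^ (n + 1)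
      * ((n + 2) * ‖l - z‖ ^ 2 - max ((R + 1) ^ 2 - ‖l - z‖ ^ 2) 0) :=
    fun l => laplacian_radialTest _ _ _ _
  have hfac : ∀ l, 1 ≤ ‖l - z‖ → 1 ≤ (n + 2) * ‖l - z‖ ^ 2 - max ((R + 1) ^ 2 - ‖l - z‖ ^ 2) 0 := by
    intro l hl
    have h1 : 1 ≤ ‖l - z‖ ^ 2 := one_le_pow₀ hl
    have h2 : max ((R + 1) ^ 2 - ‖l - z‖ ^ 2) 0 ≤ (R + 1) ^ 2 :=
      max_le (by linarith) (by positivity)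
    have h3 : (n + 2 : ℝ) * 1 ≤ (n + 2) * ‖l - z‖ ^ 2 := by gcongr
    linarith
  have hL0 : ∀ l, 1 ≤ ‖l - z‖ → 0 ≤ Laplacian.laplacian φ l := by
    intro l hl
    rw [hL]
    have := hfac l hl
    have h2 : 0 ≤ max ((R + 1) ^ 2 - ‖l - z‖ ^ 2) 0 := le_max_right _ _
    positivity
  have hL1 : ∀ l, 1 ≤ ‖l - z‖ → ‖l - z‖ ≤ R → 1 ≤ Laplacian.laplacian φ l := by
    intro l hl hlR
    rw [hL]
    have h1 := hfac l hl
    have h2 : 1 ≤ max ((R + 1) ^ 2 - ‖l - z‖ ^ 2) 0 := le_max_of_le_left (by nlinarith)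
    have h3 : 1 ≤ max ((R + 1) ^ 2 - ‖l - z‖ ^ 2) 0 ^ (n + 1) := one_le_pow₀ h2
    have h4 : (1 : ℝ) ≤ 4 * (n + 3) := by
      have : (0 : ℝ) ≤ n := Nat.cast_nonneg n
      linarith
    exact one_le_mul_of_one_le_of_one_le (one_le_mul_of_one_le_of_one_le h4 h3) h1
  refine ⟨(B + 1) * volume.real (Metric.closedBall z (R + 1)), fun f M hf hfL hM hfM hf0 => ?_⟩
  have i1 : Integrable fun l => (M - f l) * Laplacian.laplacian φ l :=
    ((continuous_const.sub hf.continuous).mul hLc).integrable_of_hasCompactSupport hLs.mul_left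
  have i2 : Integrable ((Metric.closedBall z (R + 1)).indicator fun _ => M * (B + 1)) :=
    (integrable_indicator_iff measurableSet_closedBall).2
      (integrableOn_const measure_closedBall_lt_top.ne)
  have i3 : Integrable ((Metric.closedBall z R).indicator fun l => M - f l) :=
    (integrable_indicator_iff measurableSet_closedBall).2
      ((continuous_const.sub hf.continuous).continuousOn.integrableOn_compact
        (isCompact_closedBall _ _))
  have hneg : ∫ l, (M - f l) * Laplacian.laplacian φ l ≤ 0 := by
    have e1 : ∫ l, M * Laplacian.laplacian φ l = 0 := by
      rw [integral_mul_laplacian (f := fun _ => M) contDiff_const hφs hφc]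
      simp
    have e2 : 0 ≤ ∫ l, f l * Laplacian.laplacian φ l := by
      rw [integral_mul_laplacian hf hφs hφc]
      exact integral_nonneg fun l => mul_nonneg (hfL l) (hφ0 l)
    have j1 : Integrable fun l => M * Laplacian.laplacian φ l :=
      (continuous_const.mul hLc).integrable_of_hasCompactSupport hLs.mul_left
    have j2 : Integrable fun l => f l * Laplacian.laplacian φ l :=
      (hf.continuous.mul hLc).integrable_of_hasCompactSupport hLs.mul_left
    simp only [sub_mul]
    rw [integral_sub j1 j2, e1]
    linarith
  have hpt : ∀ l, (Metric.closedBall z R).indicator (fun l => M - f l) l ≤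
      (M - f l) * Laplacian.laplacian φ l +
        (Metric.closedBall z (R + 1)).indicator (fun _ => M * (B + 1)) l := by
    intro l
    by_cases hl2 : l ∈ Metric.closedBall z (R + 1)
    · have hg : 0 ≤ M - f l := sub_nonneg.2 (hfM l hl2)
      rw [Set.indicator_of_mem hl2]
      by_cases hl1 : ‖l - z‖ < 1
      · have hf1 := hf0 l (by rw [Metric.mem_closedBall, dist_eq_norm]; exact hl1.le)
        have h3 : -B ≤ Laplacian.laplacian φ l := (abs_le.1 (hB l)).1
        have h4 : (Metric.closedBall z R).indicator (fun l => M - f l) l ≤ M - f l :=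
          Set.indicator_le_self' (fun _ _ => hg) l
        nlinarith
      · rw [not_lt] at hl1
        have h5 : 0 ≤ M * (B + 1) := by positivity
        by_cases hlR : l ∈ Metric.closedBall z R
        · rw [Set.indicator_of_mem hlR]
          have := hL1 l hl1 (by rwa [Metric.mem_closedBall, dist_eq_norm] at hlR)
          nlinarith
        · rw [Set.indicator_of_notMem hlR]
          have := mul_nonneg hg (hL0 l hl1)
          linarith
    · have hlR : l ∉ Metric.closedBall z R :=
        fun h => hl2 (Metric.closedBall_subset_closedBall (by linarith) h)
      have h6 : Laplacian.laplacian φ l = 0 := by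
        rw [hL, max_eq_right]
        · simp
        · rw [Metric.mem_closedBall, dist_eq_norm, not_le] at hl2
          nlinarith
      rw [Set.indicator_of_notMem hlR, Set.indicator_of_notMem hl2, h6]
      simp
  calc ∫ l in Metric.closedBall z R, (M - f l)
      = ∫ l, (Metric.closedBall z R).indicator (fun l => M - f l) l :=
        (integral_indicator measurableSet_closedBall).symm
    _ ≤ ∫ l, ((M - f l) * Laplacian.laplacian φ l +
        (Metric.closedBall z (R + 1)).indicator (fun _ => M * (B + 1)) l) :=
        integral_mono i3 (i1.add i2) hpt
    _ ≤ 0 + volume.real (Metric.closedBall z (R + 1)) * (M * (B + 1)) := by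
        rw [integral_add i1 i2, integral_indicator measurableSet_closedBall, setIntegral_const,
          smul_eq_mul]
        gcongr
    _ = _ := by ring

/-! ### Decreasing limits of subharmonic functions and their Riesz measures -/

/-- A family `L ε`, `ε > 0`, of smooth subharmonic functions on the plane, decreasing as `ε`
decreases to `0` and nonnegative outside a disc which does not depend on `ε`. -/
structure IsSubharmonicRegularization (L : ℝ → ℂ → ℝ) : Prop where
  contDiff : ∀ ε, 0 < ε → ContDiff ℝ 2 (L ε)
  laplacian_nonneg : ∀ ε, 0 < ε → ∀ l, 0 ≤ Laplacian.laplacian (L ε) l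
  mono : ∀ ε δ, 0 < ε → ε ≤ δ → ∀ l, L ε l ≤ L δ l
  nonneg_of_le_norm : ∃ r, ∀ ε, 0 < ε → ∀ l, r ≤ ‖l‖ → 0 ≤ L ε l

/-- The limit of `L ε` as `ε → 0⁺`, with values in `[-∞, ∞]`. -/
noncomputable def limitPotential (L : ℝ → ℂ → ℝ) (l : ℂ) : EReal :=
  limUnder (𝓝[>] (0 : ℝ)) fun ε => (L ε l : EReal)

namespace IsSubharmonicRegularization

variable {L : ℝ → ℂ → ℝ} (hL : IsSubharmonicRegularization L)
include hL

theorem tendsto_limitPotential (l : ℂ) :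
    Tendsto (fun ε => (L ε l : EReal)) (𝓝[>] 0) (𝓝 (limitPotential L l)) := by
  have h : MonotoneOn (fun ε => (L ε l : EReal)) (Set.Ioi 0) := fun ε hε δ _ h =>
    EReal.coe_le_coe_iff.2 (hL.mono ε δ hε h l)
  exact tendsto_nhds_limUnder ⟨_, h.tendsto_nhdsGT (OrderBot.bddBelow _)⟩

theorem limitPotential_le {ε : ℝ} (hε : 0 < ε) (l : ℂ) : limitPotential L l ≤ L ε l := by
  refine le_of_tendsto (hL.tendsto_limitPotential l) ?_
  filter_upwards [Ioo_mem_nhdsGT hε] with δ hδ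
  exact EReal.coe_le_coe_iff.2 (hL.mono δ ε hδ.1 hδ.2.le l)

theorem limitPotential_ne_top (l : ℂ) : limitPotential L l ≠ ⊤ :=
  ((hL.limitPotential_le one_pos l).trans_lt (EReal.coe_lt_top _)).ne

theorem tendsto_toReal {l : ℂ} (hl : limitPotential L l ≠ ⊥) :
    Tendsto (fun ε => L ε l) (𝓝[>] 0) (𝓝 (limitPotential L l).toReal) := by
  simpa [Function.comp_def] using (EReal.tendsto_toReal (hL.limitPotential_ne_top l) hl).comp
    (hL.tendsto_limitPotential l)

theorem toReal_limitPotential_le {l : ℂ} (hl : limitPotential L l ≠ ⊥) {ε : ℝ} (hε : 0 < ε) :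
    (limitPotential L l).toReal ≤ L ε l :=
  EReal.toReal_le_toReal (hL.limitPotential_le hε l) hl (EReal.coe_ne_top _)

/-- The limit is finite almost everywhere and integrable on large discs, by monotone convergence and
the lower bound for integrals of subharmonic functions. The centre of the discs is chosen in the
region where the functions are known to be nonnegative. -/
theorem exists_integrableOn_closedBall : ∃ z : ℂ, ∀ R : ℝ, 1 ≤ R →
    (∀ᵐ l ∂volume.restrict (Metric.closedBall z R), limitPotential L l ≠ ⊥) ∧
    IntegrableOn (fun l => (limitPotential L l).toReal) (Metric.closedBall z R) := by
  obtain ⟨r, hr⟩ := hL.nonneg_of_le_norm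
  refine ⟨((|r| + 1 : ℝ) : ℂ), fun R hR => ?_⟩
  set z : ℂ := ((|r| + 1 : ℝ) : ℂ) with hz
  set D := Metric.closedBall z R with hD
  have hzn : ‖z‖ = |r| + 1 := by
    rw [hz, Complex.norm_real, Real.norm_of_nonneg (by positivity)]
  have hnear : ∀ ε, 0 < ε → ∀ l ∈ Metric.closedBall z 1, 0 ≤ L ε l := by
    intro ε hε l hl
    refine hr ε hε l ?_
    rw [Metric.mem_closedBall, dist_comm, dist_eq_norm] at hl
    have := norm_sub_norm_le z l
    linarith [le_abs_self r]
  obtain ⟨K, hK⟩ := exists_setIntegral_sub_le z hR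
  obtain ⟨M, hM⟩ := (isCompact_closedBall z (R + 1)).bddAbove_image
    (hL.contDiff 1 one_pos).continuous.continuousOn
  have hM1 : ∀ ε, 0 < ε → ε ≤ 1 → ∀ l ∈ Metric.closedBall z (R + 1), L ε l ≤ M :=
    fun ε hε hε1 l hl => (hL.mono ε 1 hε hε1 l).trans (hM ⟨l, hl, rfl⟩)
  have hM0 : 0 ≤ M := by
    have hzmem : z ∈ Metric.closedBall z (R + 1) := Metric.mem_closedBall_self (by linarith)
    exact (hnear 1 one_pos z (Metric.mem_closedBall_self zero_le_one)).trans
      (hM1 1 one_pos le_rfl z hzmem)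
  set s : ℕ → ℝ := fun n => 1 / ((n : ℝ) + 1) with hs
  have hs0 : ∀ n, 0 < s n := fun n => Nat.one_div_pos_of_nat
  have hs1 : ∀ n, s n ≤ 1 := fun n => by
    rw [hs, div_le_one (by positivity)]
    linarith [Nat.cast_nonneg (α := ℝ) n]
  have hsl : Tendsto s atTop (𝓝[>] 0) := tendsto_nhdsWithin_iff.2
    ⟨tendsto_one_div_add_atTop_nhds_zero_nat, Eventually.of_forall hs0⟩
  have hsub : D ⊆ Metric.closedBall z (R + 1) := Metric.closedBall_subset_closedBall (by linarith)
  set g : ℕ → ℂ → ENNReal := fun n l => ENNReal.ofReal (M - L (s n) l) with hg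
  have hgm : ∀ n, Measurable (g n) := fun n =>
    (measurable_const.sub (hL.contDiff _ (hs0 n)).continuous.measurable).ennreal_ofReal
  have hgmono : Monotone g := by
    intro m n hmn l
    refine ENNReal.ofReal_le_ofReal (sub_le_sub_left (hL.mono _ _ (hs0 n) ?_ l) _)
    exact Nat.one_div_le_one_div hmn
  have hgint : ∀ n, ∫⁻ l in D, g n l ≤ ENNReal.ofReal (M * K) := by
    intro n
    rw [hg, ← ofReal_integral_eq_lintegral_ofReal]
    · exact ENNReal.ofReal_le_ofReal (hK (L (s n)) M (hL.contDiff _ (hs0 n))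
        (hL.laplacian_nonneg _ (hs0 n)) hM0 (hM1 _ (hs0 n) (hs1 n)) (hnear _ (hs0 n)))
    · exact (continuous_const.sub (hL.contDiff _ (hs0 n)).continuous).continuousOn
        |>.integrableOn_compact (isCompact_closedBall _ _)
    · exact ae_restrict_of_forall_mem measurableSet_closedBall fun l hl =>
        sub_nonneg.2 (hM1 _ (hs0 n) (hs1 n) l (hsub hl))
  have hsup : ∫⁻ l in D, ⨆ n, g n l ≤ ENNReal.ofReal (M * K) := by
    rw [lintegral_iSup hgm hgmono]
    exact iSup_le hgint
  have hfin : ∀ᵐ l ∂volume.restrict D, ⨆ n, g n l < ⊤ :=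
    ae_lt_top (Measurable.iSup hgm) (hsup.trans_lt ENNReal.ofReal_lt_top).ne
  have hbot : ∀ l, ⨆ n, g n l < ⊤ → limitPotential L l ≠ ⊥ := by
    intro l hl hb
    have h1 : Tendsto (fun n => (L (s n) l : EReal)) atTop (𝓝 ⊥) := by
      rw [← hb]
      exact (hL.tendsto_limitPotential l).comp hsl
    rw [EReal.tendsto_nhds_bot_iff_real] at h1
    obtain ⟨n, hn⟩ := (h1 (M - (⨆ n, g n l).toReal - 1)).exists
    rw [EReal.coe_lt_coe_iff] at hn
    have h2 : g n l ≤ ⨆ n, g n l := le_iSup (fun n => g n l) n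
    have h3 : M - L (s n) l ≤ (⨆ n, g n l).toReal := (ENNReal.ofReal_le_iff_le_toReal hl.ne).1 h2
    linarith
  have hlim : ∀ᵐ l ∂volume.restrict D, Tendsto (fun n => L (s n) l) atTop
      (𝓝 (limitPotential L l).toReal) := by
    filter_upwards [hfin] with l hl
    exact (hL.tendsto_toReal (hbot l hl)).comp hsl
  refine ⟨by filter_upwards [hfin] with l hl using hbot l hl, ?_⟩
  have hmeas : AEStronglyMeasurable (fun l => (limitPotential L l).toReal) (volume.restrict D) :=
    aestronglyMeasurable_of_tendsto_ae atTop
      (fun n => (hL.contDiff _ (hs0 n)).continuous.aestronglyMeasurable) hlim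
  have hconst : IntegrableOn (fun _ : ℂ => M) D :=
    integrableOn_const measure_closedBall_lt_top.ne
  have hint : IntegrableOn (fun l => M - (limitPotential L l).toReal) D := by
    refine ⟨aestronglyMeasurable_const.sub hmeas, ?_⟩
    rw [hasFiniteIntegral_iff_enorm]
    refine lt_of_le_of_lt (lintegral_mono_ae ?_) (hsup.trans_lt ENNReal.ofReal_lt_top)
    filter_upwards [hfin, hlim, ae_restrict_mem measurableSet_closedBall] with l hl hl2 hl3
    have h0 : 0 ≤ M - (limitPotential L l).toReal :=
      sub_nonneg.2 ((hL.toReal_limitPotential_le (hbot l hl) one_pos).trans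
        (hM1 1 one_pos le_rfl l (hsub hl3)))
    rw [Real.enorm_of_nonneg h0]
    have h1 : Tendsto (fun n => g n l) atTop
        (𝓝 (ENNReal.ofReal (M - (limitPotential L l).toReal))) :=
      ENNReal.tendsto_ofReal (hl2.const_sub M)
    exact le_of_tendsto' h1 fun n => le_iSup (fun n => g n l) n
  have := hconst.sub hint
  refine this.congr (Eventually.of_forall fun l => ?_)
  simp

theorem ae_ne_bot : ∀ᵐ l : ℂ, limitPotential L l ≠ ⊥ := by
  obtain ⟨z, hz⟩ := hL.exists_integrableOn_closedBall
  have h : ∀ᵐ l ∂volume.restrict (⋃ n : ℕ, Metric.closedBall z (n + 1 : ℕ)),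
      limitPotential L l ≠ ⊥ := by
    rw [ae_restrict_iUnion_iff]
    exact fun n => (hz _ (by simp)).1
  have hU : ⋃ n : ℕ, Metric.closedBall z (n + 1 : ℕ) = Set.univ := by
    rw [Set.eq_univ_iff_forall]
    intro l
    obtain ⟨n, hn⟩ := exists_nat_ge (dist l z)
    rw [Set.mem_iUnion]
    exact ⟨n, Metric.mem_closedBall.2 (hn.trans (by simp))⟩
  rwa [hU, Measure.restrict_univ] at h

theorem locallyIntegrable : LocallyIntegrable fun l => (limitPotential L l).toReal := by
  obtain ⟨z, hz⟩ := hL.exists_integrableOn_closedBall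
  rw [locallyIntegrable_iff]
  intro k hk
  obtain ⟨R, hR⟩ := hk.isBounded.subset_closedBall z
  exact (hz (max R 1) (le_max_right _ _)).2.mono_set
    (hR.trans (Metric.closedBall_subset_closedBall (le_max_left _ _)))

theorem tendsto_integral_mul {ψ : ℂ → ℝ} (hψ : Continuous ψ) (hc : HasCompactSupport ψ) :
    Tendsto (fun ε => ∫ l, L ε l * ψ l) (𝓝[>] 0)
      (𝓝 (∫ l, (limitPotential L l).toReal * ψ l)) := by
  have h1 : Continuous (L 1) := (hL.contDiff 1 one_pos).continuous
  have i1 : Integrable fun l => (limitPotential L l).toReal * ψ l :=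
    hL.locallyIntegrable.integrable_smul_right_of_hasCompactSupport hψ hc
  have i2 : Integrable fun l => L 1 l * ψ l :=
    (h1.mul hψ).integrable_of_hasCompactSupport hc.mul_left
  refine tendsto_integral_filter_of_dominated_convergence
    (fun l => ‖(limitPotential L l).toReal * ψ l‖ + ‖L 1 l * ψ l‖) ?_ ?_ (i1.norm.add i2.norm) ?_
  · filter_upwards [self_mem_nhdsWithin] with ε hε
    exact ((hL.contDiff ε hε).continuous.mul hψ).aestronglyMeasurable
  · filter_upwards [Ioo_mem_nhdsGT one_pos] with ε hε
    filter_upwards [hL.ae_ne_bot] with l hl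
    rw [norm_mul, norm_mul, norm_mul, ← add_mul]
    gcongr
    have h2 := hL.toReal_limitPotential_le hl hε.1
    have h3 := hL.mono ε 1 hε.1 hε.2.le l
    simp only [Real.norm_eq_abs]
    rw [abs_le]
    constructor
    · linarith [neg_abs_le (limitPotential L l).toReal, abs_nonneg (L 1 l)]
    · linarith [le_abs_self (L 1 l), abs_nonneg (limitPotential L l).toReal]
  · filter_upwards [hL.ae_ne_bot] with l hl
    exact (hL.tendsto_toReal hl).mul_const _

/-- Integrals against the Laplacians of `L ε` converge to the distributional Laplacian of the
limit. -/
theorem tendsto_integral_laplacian_mul {φ : ℂ → ℝ} (hφ : ContDiff ℝ 2 φ)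
    (hc : HasCompactSupport φ) :
    Tendsto (fun ε => ∫ l, Laplacian.laplacian (L ε) l * φ l) (𝓝[>] 0)
      (𝓝 (∫ l, (limitPotential L l).toReal * Laplacian.laplacian φ l)) := by
  refine (hL.tendsto_integral_mul (continuous_laplacian hφ)
    (hasCompactSupport_laplacian hφ hc)).congr' ?_
  filter_upwards [self_mem_nhdsWithin] with ε hε
  exact integral_mul_laplacian (hL.contDiff ε hε) hφ hc

theorem integrable_laplacian_mul {ε : ℝ} (hε : 0 < ε) {f : ℂ → ℝ} (hf : Continuous f)
    (hc : HasCompactSupport f) : Integrable fun l => Laplacian.laplacian (L ε) l * f l :=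
  ((continuous_laplacian (hL.contDiff ε hε)).mul hf).integrable_of_hasCompactSupport hc.mul_left

/-- The measures with densities `∇² (L ε)` are bounded on each compact set, uniformly in `ε`. -/
theorem exists_bound_integral_laplacian_mul (f : ℂ → ℝ) (hf : Continuous f)
    (hc : HasCompactSupport f) :
    ∃ C : ℝ, ∀ᶠ ε in 𝓝[>] 0, |∫ l, Laplacian.laplacian (L ε) l * f l| ≤ C := by
  obtain ⟨B, hB⟩ := hf.bounded_above_of_compact_support hc
  obtain ⟨R, hR⟩ := hc.isCompact.isBounded.subset_closedBall 0
  let ψ : ContDiffBump (0 : ℂ) :=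
    { rIn := max R 1
      rOut := max R 1 + 1
      rIn_pos := by positivity
      rIn_lt_rOut := by linarith }
  have hψs : ContDiff ℝ 2 ψ := ψ.contDiff
  have hfψ : ∀ l, |f l| ≤ B * ψ l := by
    intro l
    by_cases hl : l ∈ tsupport f
    · rw [ψ.one_of_mem_closedBall (Metric.closedBall_subset_closedBall (le_max_left _ _) (hR hl)),
        mul_one]
      exact hB l
    · rw [image_eq_zero_of_notMem_tsupport hl, abs_zero]
      exact mul_nonneg ((norm_nonneg _).trans (hB 0)) ψ.nonneg
  have hlim := (hL.tendsto_integral_laplacian_mul hψs ψ.hasCompactSupport).const_mul B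
  refine ⟨B * (∫ l, (limitPotential L l).toReal * Laplacian.laplacian (⇑ψ) l) + 1, ?_⟩
  filter_upwards [hlim.eventually_le_const (lt_add_one _), self_mem_nhdsWithin] with ε hε hε0
  refine le_trans ?_ hε
  rw [← integral_const_mul]
  refine (abs_integral_le_integral_abs).trans (integral_mono
    (hL.integrable_laplacian_mul hε0 hf hc).abs
    ((hL.integrable_laplacian_mul hε0 ψ.continuous ψ.hasCompactSupport).const_mul B) fun l => ?_)
  simp only [abs_mul, abs_of_nonneg (hL.laplacian_nonneg ε hε0 l)]
  calc _ ≤ Laplacian.laplacian (L ε) l * (B * ψ l) := by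
        gcongr
        · exact hL.laplacian_nonneg ε hε0 l
        · exact hfψ l
    _ = _ := by ring

/-- The distributional Laplacian of the limit is a positive measure. It is obtained by the
Riesz-Markov-Kakutani theorem from a limit, along an ultrafilter, of the functionals given by the
densities `∇² (L ε)`. -/
theorem exists_measure : ∃ μ : Measure ℂ, IsLocallyFiniteMeasure μ ∧
    ∀ φ : ℂ → ℝ, ContDiff ℝ 2 φ → HasCompactSupport φ →
      ∫ l, φ l ∂μ = ∫ l, (limitPotential L l).toReal * Laplacian.laplacian φ l := by
  set 𝒰 : Ultrafilter ℝ := Ultrafilter.of (𝓝[>] 0) with h𝒰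
  have hle : (𝒰 : Filter ℝ) ≤ 𝓝[>] 0 := Ultrafilter.of_le _
  have hpos : ∀ᶠ ε in (𝒰 : Filter ℝ), 0 < ε := hle self_mem_nhdsWithin
  have hex : ∀ f : CompactlySupportedContinuousMap ℂ ℝ, ∃ c : ℝ,
      Tendsto (fun ε => ∫ l, Laplacian.laplacian (L ε) l * f l) 𝒰 (𝓝 c) := by
    intro f
    obtain ⟨C, hC⟩ := hL.exists_bound_integral_laplacian_mul f f.continuous f.hasCompactSupport
    have hmem : ∀ᶠ ε in (𝒰 : Filter ℝ),
        (∫ l, Laplacian.laplacian (L ε) l * f l) ∈ Set.Icc (-C) C :=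
      (hC.filter_mono hle).mono fun ε hε => abs_le.1 hε
    obtain ⟨c, -, hc⟩ := (isCompact_Icc (a := -C) (b := C)).ultrafilter_le_nhds
      (𝒰.map fun ε => ∫ l, Laplacian.laplacian (L ε) l * f l) (le_principal_iff.2 hmem)
    exact ⟨c, hc⟩
  choose Λ hΛ using hex
  set Λ₀ : CompactlySupportedContinuousMap ℂ ℝ →ₗ[ℝ] ℝ :=
    { toFun := Λ
      map_add' := by
        intro f g
        refine tendsto_nhds_unique (hΛ (f + g)) (((hΛ f).add (hΛ g)).congr' ?_)
        filter_upwards [hpos] with ε hε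
        refine (integral_add (hL.integrable_laplacian_mul hε f.continuous f.hasCompactSupport)
          (hL.integrable_laplacian_mul hε g.continuous g.hasCompactSupport)).symm.trans ?_
        congr 1 with l
        exact (mul_add _ _ _).symm
      map_smul' := by
        intro c f
        refine tendsto_nhds_unique (hΛ (c • f)) (((hΛ f).const_mul c).congr fun ε => ?_)
        rw [← integral_const_mul]
        congr 1 with l
        simp
        ring } with hΛ₀
  set Λ₁ := PositiveLinearMap.mk₀ Λ₀ (by
    intro f hf
    refine ge_of_tendsto (hΛ f) ?_
    filter_upwards [hpos] with ε hε
    exact integral_nonneg fun l => mul_nonneg (hL.laplacian_nonneg ε hε l) (hf l)) with hΛ₁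
  refine ⟨RealRMK.rieszMeasure Λ₁, inferInstance, fun φ hφ hc => ?_⟩
  have h1 := RealRMK.integral_rieszMeasure Λ₁ ⟨⟨φ, hφ.continuous⟩, hc⟩
  refine h1.trans ?_
  exact tendsto_nhds_unique (hΛ _) ((hL.tendsto_integral_laplacian_mul hφ hc).mono_left hle)

end IsSubharmonicRegularization

/-! ### Existence, uniqueness and support of the Brown measure -/

namespace FaithfulNormalTrace

variable {A : Type u} [CStarAlgebra A] [PartialOrder A] [StarOrderedRing A] [WStarAlgebra A]
  (τ : FaithfulNormalTrace A) (a : A)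

theorem isSubharmonicRegularization_regLogDet :
    IsSubharmonicRegularization (τ.regLogDet a) where
  contDiff _ hε := τ.contDiff_regLogDet a hε
  laplacian_nonneg _ hε := τ.laplacian_regLogDet_nonneg a hε
  mono _ _ hε h := τ.regLogDet_mono a hε h
  nonneg_of_le_norm := ⟨2 * ‖a‖ + 1, fun _ hε _ hl => τ.regLogDet_nonneg a hε hl⟩

theorem exists_isBrownMeasure : ∃ μ : Measure ℂ, τ.IsBrownMeasure a μ := by
  have hL := τ.isSubharmonicRegularization_regLogDet a
  obtain ⟨μ, hμ, hint⟩ := hL.exists_measure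
  have h2 : 0 ≤ (2 * Real.pi)⁻¹ := by positivity
  -- By definition `τ.logDet (a - l)` is `limitPotential (τ.regLogDet a) l`.
  refine ⟨ENNReal.ofReal (2 * Real.pi)⁻¹ • μ, ?_, hL.ae_ne_bot, hL.locallyIntegrable, ?_⟩
  · constructor
    intro z
    obtain ⟨s, hs, hs2⟩ := μ.finiteAt_nhds z
    exact ⟨s, hs, by simpa using ENNReal.mul_lt_top ENNReal.ofReal_lt_top hs2⟩
  · intro φ hφ hc
    rw [integral_smul_measure, hint φ (contDiff_infty.1 hφ 2) hc,
      ENNReal.toReal_ofReal h2, smul_eq_mul]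
    rfl

variable {τ a}

theorem IsBrownMeasure.unique {μ ν : Measure ℂ} (hμ : τ.IsBrownMeasure a μ)
    (hν : τ.IsBrownMeasure a ν) : μ = ν := by
  have := hμ.locallyFinite
  have := hν.locallyFinite
  refine measure_ext_of_integral_contDiff fun φ hφ hc => ?_
  rw [hμ.integral_eq φ hφ hc, hν.integral_eq φ hφ hc]

/-- Near a point of the `L²₂`-resolvent set, the Laplacian of `½ τ(log ((a - l)⋆ (a - l) + ε))` is
`O(ε)`, uniformly; hence the Brown measure vanishes there. -/
theorem IsBrownMeasure.support_subset {μ : Measure ℂ} (hμ : τ.IsBrownMeasure a μ) :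
    μ.support ⊆ τ.l2Spectrum 2 a := by
  have := hμ.locallyFinite
  rw [l2Spectrum, Set.subset_compl_comm]
  rintro l₀ ⟨C, hC⟩
  obtain ⟨r, hr, hball⟩ := Metric.eventually_nhds_iff_ball.1 hC
  let φ : ContDiffBump l₀ :=
    { rIn := r / 2
      rOut := r
      rIn_pos := by positivity
      rIn_lt_rOut := by linarith }
  have hφs : ContDiff ℝ ∞ φ := φ.contDiff
  have hφc : HasCompactSupport φ := φ.hasCompactSupport
  have hL := τ.isSubharmonicRegularization_regLogDet a
  have hlim := hL.tendsto_integral_laplacian_mul (φ := φ) φ.contDiff hφc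
  have hbound : ∀ ε : ℝ, 0 < ε → ∫ l, Laplacian.laplacian (τ.regLogDet a ε) l * φ l ≤
      2 * ε * C ^ 2 * ∫ l, φ l := by
    intro ε hε
    rw [← integral_const_mul]
    refine integral_mono (hL.integrable_laplacian_mul hε φ.continuous hφc)
      ((φ.continuous.integrable_of_hasCompactSupport hφc).const_mul _) fun l => ?_
    by_cases hl : l ∈ Metric.ball l₀ r
    · obtain ⟨b, hb, hbC⟩ := hball l hl
      have h1 := τ.reTrace_shiftInv_mul_shiftInv_le hb hε
      have h2 : ‖b‖ ^ 2 ≤ C ^ 2 := by gcongr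
      simp only [τ.laplacian_regLogDet a hε]
      gcongr
      · exact φ.nonneg
      · exact h1.trans h2
    · have : φ l = 0 := by
        rw [← Function.notMem_support, φ.support_eq]
        exact hl
      simp [this]
  have hzero : ∫ l, φ l ∂μ ≤ 0 := by
    rw [hμ.integral_eq φ hφs hφc]
    refine mul_nonpos_of_nonneg_of_nonpos (by positivity) ?_
    have hlim2 : Tendsto (fun ε : ℝ => 2 * ε * C ^ 2 * ∫ l, φ l) (𝓝[>] 0) (𝓝 0) := by
      have h : Continuous fun ε : ℝ => 2 * ε * C ^ 2 * ∫ l, φ l := by fun_prop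
      simpa using (h.tendsto 0).mono_left nhdsWithin_le_nhds
    refine le_of_tendsto_of_tendsto hlim hlim2 ?_
    filter_upwards [self_mem_nhdsWithin] with ε hε using hbound ε hε
  have hint : Integrable φ μ := φ.continuous.integrable_of_hasCompactSupport hφc
  have hae : φ =ᵐ[μ] 0 := (integral_eq_zero_iff_of_nonneg (fun _ => φ.nonneg) hint).1
    (le_antisymm hzero (integral_nonneg fun _ => φ.nonneg))
  rw [Set.mem_compl_iff, Measure.notMem_support_iff_exists]
  refine ⟨Metric.ball l₀ r, Metric.ball_mem_nhds _ hr, measure_mono_null (fun l hl => ?_)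
    (ae_iff.1 hae)⟩
  rw [← show Function.support φ = Metric.ball l₀ r from φ.support_eq] at hl
  exact hl

end FaithfulNormalTrace

theorem theorem6p2 {A : Type u} [CStarAlgebra A] [PartialOrder A] [StarOrderedRing A]
    [WStarAlgebra A] (τ : FaithfulNormalTrace A) (a : A) :
    (∃! μ : Measure ℂ, τ.IsBrownMeasure a μ) ∧
    (∀ μ : Measure ℂ, τ.IsBrownMeasure a μ → μ.support ⊆ τ.l2Spectrum 2 a) ∧
    τ.l2Spectrum 2 a ⊆ spectrum ℂ a := by
  obtain ⟨μ, hμ⟩ := τ.exists_isBrownMeasure a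
  exact ⟨⟨μ, hμ, fun ν hν => hν.unique hμ⟩, fun ν hν => hν.support_subset,
    τ.l2Spectrum_subset_spectrum 2 a⟩
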